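/- **Ribbon graphs.** A ribbon graph $\mathbb{G}=(V,E)$ is a compact surface with boundary, presented as a union of a finite set $V$ of discs (vertices) and a finite set $E$ of discs (edges) such that vertices and edges meet in disjoint line segments, each segment lies on the boundary of exactly one vertex and exactly one edge, and each edge contains exactly two segments. Let $F(\mathbb{G})$ be its set of boundary components. A *coloured ribbon graph* is a ribbon graph with a partition of $V(\mathbb{G})$ into vertex colour classes and a partition of $F(\mathbb{G})$ into boundary colour classes. Coloured ribbon graphs are considered up to equivalence, i.e. up to homeomorphisms that map vertices to vertices and edges to edges and preserve both partitions. **Deletion and contraction.** $\mathbb{G}\backslash e$ is obtained by removing the disc $e$. The vertices keep their colours; the colour classes of the (one or two) boundary components touching $e$ are merged, and the new boundary components belong to the merged class. $\mathbb{G}/e$ is obtained by attaching a disc (a new vertex) along each boundary component of $e\cup\{u,v\}$, where $u,v$ are the (not necessarily distinct) vertices incident with $e$, and then removing $e,u,v$. The boundary components keep their colours; the colour classes of $u$ and $v$ are merged, and the new vertices belong to the merged class. For a set $A$ of edges, $\mathbb{G}\backslash A$ and $\mathbb{G}/A$ are obtained by deleting, respectively contracting, all edges in $A$; write $e^c=E\setminus\{e\}$.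 **Edge types.** There are five connected coloured ribbon graphs with one edge: $\mathrm{bs}$ and $\mathrm{bp}$, in which the edge joins two vertices, of distinct colours in $\mathrm{bs}$ and of the same colour in $\mathrm{bp}$; $\mathrm{olc}$ and $\mathrm{olh}$, in which the edge and one vertex form an annulus, whose two boundary components have distinct colours in $\mathrm{olc}$ and the same colour in $\mathrm{olh}$; and $\mathrm{nl}$, in which the edge and one vertex form a Möbius band. An edge $e$ of $\mathbb{G}$ is of type $(i,j)$, for $i,j\in\{\mathrm{bs},\mathrm{bp},\mathrm{olc},\mathrm{olh},\mathrm{nl}\}$, if the pair $(\mathbb{G}/e^c,\ \mathbb{G}\backslash e^c)$ is $(i,j)$ after disregarding isolated vertices. **Theorem 3.4.** There is a well-defined function $U$ from the set of coloured ribbon graphs to $$\mathbb{Z}[\alpha,\beta,\gamma,a_{\mathrm{bs}},a_{\mathrm{bp}}^{1/2},a_{\mathrm{olc}},a_{\mathrm{olh}}^{1/2},b_{\mathrm{bs}},b_{\mathrm{bp}}^{1/2},b_{\mathrm{olc}},b_{\mathrm{olh}}^{1/2}]$$ given by $$U(\mathbb{G})=\begin{cases}a_i\,U(\mathbb{G}\backslash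 e)+b_j\,U(\mathbb{G}/e)&\text{if } e \text{ is an edge of type }(i,j),\\ \alpha^n\beta^m\gamma^v&\text{if }\mathbb{G}\text{ is edgeless, with } v \text{ vertices, } n \text{ vertex colour classes and } m \text{ boundary colour classes,}\end{cases}$$ where $a_{\mathrm{nl}}=a_{\mathrm{bp}}^{1/2}a_{\mathrm{olh}}^{1/2}$ and $b_{\mathrm{nl}}=b_{\mathrm{bp}}^{1/2}b_{\mathrm{olh}}^{1/2}$. That is, there is exactly one function $U$ that satisfies these relations for every coloured ribbon graph $\mathbb{G}$ and every edge $e$ of $\mathbb{G}$ (so the value does not depend on the order in which the edges are processed), and it takes equal values on equivalent coloured ribbon graphs. -/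

import Mathlib

universe u

/-! Ribbon graphs are encoded by their corners. An edge of a ribbon graph is a rectangle; two opposite
sides of it (its two *ends*) are the line segments in which it meets vertex discs, and the two other
sides are free, that is, they lie on the boundary of the ribbon graph. The corner `(e, i, s)` of the
edge `e` lies on its end `i` and on its free side `s`. -/

/-- The corners of the edges: `(e, i, s)` is the corner of `e` on the end `i` and the free side `s`. -/
abbrev Corner (E : Type u) : Type u := E × Bool × Bool

namespace Corner

variable {E : Type u}

/-- The other corner on the same end: move along the line segment where the edge meets a vertex. -/
def flipSide (x : Corner E) : Corner E := (x.1, x.2.1, !x.2.2)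

/-- The other corner on the same free side: move along the edge to its other end. -/
def flipEnd (x : Corner E) : Corner E := (x.1, !x.2.1, x.2.2)

end Corner

open Corner

/-- A (finite) ribbon graph. `E` is the set of edges and `K` is the set of isolated vertices (vertex
discs meeting no edge). The boundary circles of the other vertex discs are cut by the ends of the edges
into free arcs, each of which joins two distinct corners; `arc x` is the corner joined to `x`.
Each fixed-point-free involution `arc` arises from a ribbon graph, which it determines up to
equivalence. -/
structure RibbonGraph : Type (u + 1) where
  E : Type u
  K : Type u
  finite_E : Finite E
  finite_K : Finite K
  arc : Corner E → Corner E
  arc_arc : ∀ x, arc (arc x) = x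
  arc_ne : ∀ x, arc x ≠ x

/-- The two ways of removing edges. -/
inductive MinorOp
  | deletion
  | contraction

namespace RibbonGraph

variable (G : RibbonGraph.{u})

/-- A place of a ribbon graph: a corner, or an isolated vertex (which stands for its vertex disc and also
for the boundary circle of that disc). Each vertex and each boundary component has a place. -/
abbrev Place : Type u := Corner G.E ⊕ G.K

/-- The finest equivalence relation on places in which each corner `x` is equivalent to `arc x` and
to `f x`. -/
def orbitSetoid (f : Corner G.E → Corner G.E) : Setoid G.Place :=
  Relation.EqvGen.setoid fun p q => ∃ x, p = Sum.inl x ∧ (q = Sum.inl (G.arc x) ∨ q = Sum.inl (f x))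

/-- Two places are at the same vertex: going round the boundary circle of a vertex disc, free arcs
and ends of edges alternate. -/
def vertexSetoid : Setoid G.Place := G.orbitSetoid flipSide

/-- Two places are on the same boundary component: going along a boundary component, free arcs of
vertex discs and free sides of edges alternate. -/
def boundarySetoid : Setoid G.Place := G.orbitSetoid flipEnd

/-- The set `V(G)` of vertices. -/
def Vertex : Type u := Quotient G.vertexSetoid

/-- The set `F(G)` of boundary components. -/
def BoundaryComponent : Type u := Quotient G.boundarySetoid

/-- How the boundary of a vertex disc of the minor passes a removed edge: if the edge is deleted, it
passes along the end of the edge; if the edge is contracted, it passes along the free side. -/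
def cross {E : Type u} : MinorOp → Corner E → Corner E
  | .deletion => flipSide
  | .contraction => flipEnd

open Classical in
/-- The move along an edge while going round a vertex disc of the minor in which the edges of `A` are
removed by `m`. -/
noncomputable def turn (m : MinorOp) (A : Set G.E) (x : Corner G.E) : Corner G.E :=
  if x.1 ∈ A then cross m x else flipSide x

/-- Two places are on the boundary of the same vertex disc of the minor. If `A` is deleted, these are
the vertices of `G`. If `A` is contracted, these are the boundary components of the spanning ribbon
subgraph with edge set `A`, to which new vertex discs are attached (before everything old but the
remaining edges is discarded). -/
noncomputable def minorVertexSetoid (m : MinorOp) (A : Set G.E) : Setoid G.Place := G.orbitSetoid (G.turn m A)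

open Classical in
/-- The map that passes a removed edge and does nothing at the other edges. -/
noncomputable def pass (m : MinorOp) (A : Set G.E) (x : Corner G.E) : Corner G.E :=
  if x.1 ∈ A then cross m x else x

lemma cross_cross {E : Type u} (m : MinorOp) (x : Corner E) : cross m (cross m x) = x := by
  cases m <;> simp [cross, flipSide, flipEnd]

lemma cross_fst {E : Type u} (m : MinorOp) (x : Corner E) : (cross m x).1 = x.1 := by
  cases m <;> rfl

lemma cross_ne {E : Type u} (m : MinorOp) (x : Corner E) : cross m x ≠ x := by
  obtain ⟨e, i, s⟩ := x
  cases m <;> simp [cross, flipSide, flipEnd]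

lemma pass_fst (m : MinorOp) (A : Set G.E) (x : Corner G.E) : (G.pass m A x).1 = x.1 := by
  unfold pass; split_ifs <;> simp [cross_fst]

lemma pass_pass (m : MinorOp) (A : Set G.E) (x : Corner G.E) :
    G.pass m A (G.pass m A x) = x := by
  by_cases h : x.1 ∈ A
  · have h2 : (cross m x).1 ∈ A := by rwa [cross_fst]
    simp [pass, h, h2, cross_cross]
  · simp [pass, h]

/-- Pass a removed edge (if at one), then move along the free arc. -/
noncomputable def walk (m : MinorOp) (A : Set G.E) : Equiv.Perm (Corner G.E) where
  toFun x := G.arc (G.pass m A x)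
  invFun x := G.pass m A (G.arc x)
  left_inv x := by simp [G.arc_arc, pass_pass]
  right_inv x := by simp [G.arc_arc, pass_pass]

lemma exists_return (m : MinorOp) (A : Set G.E) (x : Corner G.E) (hx : x.1 ∉ A) :
    ∃ k : ℕ, ((G.walk m A ^ (k + 1)) x).1 ∉ A := by
  have := G.finite_E
  obtain ⟨n, hn, h⟩ := (isOfFinOrder_of_finite (G.walk m A)).exists_pow_eq_one
  refine ⟨n - 1, ?_⟩
  rw [Nat.sub_add_cancel hn, h]
  exact hx

open Classical in
/-- One less than the number of steps that the walk from `x` takes until it is at a remaining edge. -/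
noncomputable def returnTime (m : MinorOp) (A : Set G.E) (x : Corner G.E) (hx : x.1 ∉ A) : ℕ :=
  Nat.find (G.exists_return m A x hx)

/-- The first corner of a remaining edge on the walk from `x`. -/
noncomputable def returnCorner (m : MinorOp) (A : Set G.E) (x : Corner G.E) (hx : x.1 ∉ A) :
    Corner G.E :=
  (G.walk m A ^ (G.returnTime m A x hx + 1)) x

lemma returnCorner_fst (m : MinorOp) (A : Set G.E) (x : Corner G.E) (hx : x.1 ∉ A) :
    (G.returnCorner m A x hx).1 ∉ A := by
  classical
  exact Nat.find_spec (G.exists_return m A x hx)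

lemma pass_walk_pow (m : MinorOp) (A : Set G.E) (k : ℕ) (x : Corner G.E) :
    (G.walk m A ^ k) (G.pass m A ((G.walk m A ^ k) x)) = G.pass m A x := by
  induction k generalizing x with
  | zero => rfl
  | succ k ih =>
    have h1 : (G.walk m A ^ (k + 1)) x = (G.walk m A ^ k) (G.walk m A x) := by
      rw [pow_succ, Equiv.Perm.mul_apply]
    rw [h1, pow_succ', Equiv.Perm.mul_apply, ih]
    simp [walk, pass_pass, G.arc_arc]

lemma returnCorner_returnCorner (m : MinorOp) (A : Set G.E) (x : Corner G.E) (hx : x.1 ∉ A) :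
    G.returnCorner m A (G.returnCorner m A x hx) (G.returnCorner_fst m A x hx) = x := by
  classical
  set y := G.returnCorner m A x hx with hy
  have hyA : y.1 ∉ A := G.returnCorner_fst m A x hx
  set k := G.returnTime m A x hx with hk
  have hyx : y = (G.walk m A ^ (k + 1)) x := rfl
  have px : G.pass m A x = x := by simp [pass, hx]
  have py : G.pass m A y = y := by simp [pass, hyA]
  have h0 : (G.walk m A ^ (k + 1)) y = x := by
    have := G.pass_walk_pow m A (k + 1) x
    rwa [← hyx, py, px] at this
  have hlt : ∀ j, j < k → ((G.walk m A ^ (j + 1)) x).1 ∈ A := fun j hj => by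
    have := Nat.find_min (G.exists_return m A x hx) hj
    simpa using this
  have ht : G.returnTime m A y hyA = k := by
    refine (Nat.find_eq_iff _).2 ⟨by rw [h0]; exact hx, fun j hj => ?_⟩
    have h2 : G.pass m A ((G.walk m A ^ (j + 1)) y) = (G.walk m A ^ (k - j)) x := by
      have h3 := G.pass_walk_pow m A (j + 1) ((G.walk m A ^ (k - j)) x)
      have h4 : (G.walk m A ^ (j + 1)) ((G.walk m A ^ (k - j)) x) = y := by
        rw [← Equiv.Perm.mul_apply, ← pow_add, hyx]; congr 2; omega
      rw [h4, py] at h3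
      rw [h3, pass_pass]
    have h5 := hlt (k - j - 1) (by omega)
    rw [show k - j - 1 + 1 = k - j by omega, ← h2, pass_fst] at h5
    simpa using h5
  change (G.walk m A ^ (G.returnTime m A y hyA + 1)) y = x
  rw [ht, h0]

lemma returnCorner_ne (m : MinorOp) (A : Set G.E) (x : Corner G.E) (hx : x.1 ∉ A) :
    G.returnCorner m A x hx ≠ x := by
  classical
  intro h
  set k := G.returnTime m A x hx with hk
  have h0 : (G.walk m A ^ (k + 1)) x = x := h
  have px : G.pass m A x = x := by simp [pass, hx]
  have hlt : ∀ j, j < k → ((G.walk m A ^ (j + 1)) x).1 ∈ A := fun j hj => by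
    have := Nat.find_min (G.exists_return m A x hx) hj
    simpa using this
  have key : ∀ i j, i + j = k + 1 → G.pass m A ((G.walk m A ^ i) x) = (G.walk m A ^ j) x := by
    intro i j hij
    have h3 := G.pass_walk_pow m A i ((G.walk m A ^ j) x)
    rw [← Equiv.Perm.mul_apply (G.walk m A ^ i) (G.walk m A ^ j), ← pow_add, hij, h0, px] at h3
    rw [h3, pass_pass]
  rcases Nat.even_or_odd' k with ⟨n, hn | hn⟩
  · have h1 := key n (n + 1) (by omega)
    rw [pow_succ', Equiv.Perm.mul_apply] at h1
    exact G.arc_ne _ h1.symm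
  · have h1 := key (n + 1) (n + 1) (by omega)
    have h2 := hlt n (by omega)
    simp only [pass, h2, if_true] at h1
    exact cross_ne _ _ h1

/-- The ribbon graph `G \ A` or `G / A` obtained by deleting, or contracting, the edges of `A`.
Two remaining corners are joined by a free arc if one is reached from the other by alternately moving along
free arcs of `G` and passing removed edges. The isolated vertices are the vertex discs that meet no
remaining edge. -/
noncomputable def minor (m : MinorOp) (A : Set G.E) : RibbonGraph.{u} where
  E := {e : G.E // e ∉ A}
  K := {v : Quotient (G.minorVertexSetoid m A) // ∀ x : Corner G.E,
    Quotient.mk (G.minorVertexSetoid m A) (Sum.inl x) = v → x.1 ∈ A}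
  finite_E := have := G.finite_E; inferInstance
  finite_K := have := G.finite_E; have := G.finite_K; inferInstance
  arc x := (⟨_, G.returnCorner_fst m A (x.1.1, x.2) x.1.2⟩,
    (G.returnCorner m A (x.1.1, x.2) x.1.2).2)
  arc_arc x := by
    obtain ⟨⟨e, he⟩, x⟩ := x
    have := G.returnCorner_returnCorner m A (e, x) he
    exact Prod.ext (Subtype.ext (congrArg (fun y => y.1) this)) (congrArg (fun y => y.2) this)
  arc_ne x := by
    obtain ⟨⟨e, he⟩, x⟩ := x
    intro h
    refine G.returnCorner_ne m A (e, x) he (Prod.ext ?_ ?_)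
    · exact congrArg (fun y => y.1.1) h
    · exact congrArg (fun y => y.2) h

/-- A place of `G` on a given vertex disc of the minor: a remaining corner is itself, and for an
isolated vertex of the minor it is any place of `G` on the boundary of this vertex disc (which is also a
boundary component of the minor). -/
noncomputable def minorPlace (m : MinorOp) (A : Set G.E) : (G.minor m A).Place → G.Place
  | Sum.inl x => Sum.inl (x.1.1, x.2)
  | Sum.inr v => v.1.out

/-- The finest equivalence relation on places in which all corners of each edge in `A` are equivalent. -/
def mergeSetoid (A : Set G.E) : Setoid G.Place :=
  Relation.EqvGen.setoid fun p q =>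
    ∃ x y : Corner G.E, p = Sum.inl x ∧ q = Sum.inl y ∧ x.1 ∈ A ∧ x.1 = y.1

lemma orbitSetoid_le {f : Corner G.E → Corner G.E} {S : Setoid G.Place}
    (h1 : ∀ x, S (Sum.inl x) (Sum.inl (G.arc x))) (h2 : ∀ x, S (Sum.inl x) (Sum.inl (f x))) :
    G.orbitSetoid f ≤ S := by
  intro p q h
  induction h with
  | rel p q h =>
    obtain ⟨x, rfl, rfl | rfl⟩ := h
    · exact h1 x
    · exact h2 x
  | refl p => exact S.refl p
  | symm p q _ ih => exact S.symm ih
  | trans p q r _ _ ih1 ih2 => exact S.trans ih1 ih2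

lemma orbitSetoid_arc (f : Corner G.E → Corner G.E) (x : Corner G.E) :
    G.orbitSetoid f (Sum.inl x) (Sum.inl (G.arc x)) :=
  Relation.EqvGen.rel _ _ ⟨x, rfl, Or.inl rfl⟩

lemma orbitSetoid_apply (f : Corner G.E → Corner G.E) (x : Corner G.E) :
    G.orbitSetoid f (Sum.inl x) (Sum.inl (f x)) :=
  Relation.EqvGen.rel _ _ ⟨x, rfl, Or.inr rfl⟩

lemma returnCorner_rel (m : MinorOp) (A : Set G.E) (S : Setoid G.Place)
    (h1 : ∀ x, S (Sum.inl x) (Sum.inl (G.arc x)))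
    (h2 : ∀ x : Corner G.E, x.1 ∈ A → S (Sum.inl x) (Sum.inl (cross m x)))
    (x : Corner G.E) (hx : x.1 ∉ A) :
    S (Sum.inl x) (Sum.inl (G.returnCorner m A x hx)) := by
  have hw : ∀ y, S (Sum.inl y) (Sum.inl (G.walk m A y)) := fun y => by
    refine S.trans (b := Sum.inl (G.pass m A y)) ?_ (h1 _)
    unfold pass
    split_ifs with h
    · exact h2 y h
    · exact S.refl _
  have hk : ∀ k : ℕ, S (Sum.inl x) (Sum.inl ((G.walk m A ^ k) x)) := fun k => by
    induction k with
    | zero => exact S.refl _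
    | succ k ih =>
      rw [pow_succ', Equiv.Perm.mul_apply]
      exact S.trans ih (hw _)
  exact hk _

end RibbonGraph

/-- A coloured ribbon graph. A partition of the set of vertices into colour classes is given as an
equivalence relation `vcol` on places that is coarser than being at the same vertex (the equivalence
relations on a quotient are those on the set that are coarser than the one divided out); similarly,
`bcol` is a partition of the set of boundary components. -/
structure ColouredRibbonGraph : Type (u + 1) extends RibbonGraph.{u} where
  vcol : Setoid toRibbonGraph.Place
  bcol : Setoid toRibbonGraph.Place
  vertexSetoid_le : toRibbonGraph.vertexSetoid ≤ vcol
  boundarySetoid_le : toRibbonGraph.boundarySetoid ≤ bcol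

namespace ColouredRibbonGraph

open RibbonGraph

variable (G : ColouredRibbonGraph.{u})

/-- The number of vertices. -/
noncomputable def numVertices : ℕ := Nat.card G.Vertex

/-- The number of vertex colour classes. -/
noncomputable def numVertexColours : ℕ := Nat.card (Quotient G.vcol)

/-- The number of boundary colour classes. -/
noncomputable def numBoundaryColours : ℕ := Nat.card (Quotient G.bcol)

/-- `G \ A`. The vertices keep their colours. For each edge of `A`, the colour classes of the boundary
components touching it are merged, and the boundary components that arise are in the resulting class. -/
noncomputable def delete (A : Set G.E) : ColouredRibbonGraph.{u} where
  toRibbonGraph := G.toRibbonGraph.minor .deletion A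
  vcol := Setoid.comap (G.minorPlace .deletion A) G.vcol
  bcol := Setoid.comap (G.minorPlace .deletion A) (G.bcol ⊔ G.mergeSetoid A)
  vertexSetoid_le := by
    refine orbitSetoid_le _ (fun x => ?_) fun x => ?_
    · refine G.returnCorner_rel .deletion A G.vcol (fun y => ?_) (fun y _ => ?_) (x.1.1, x.2) x.1.2
      · exact G.vertexSetoid_le (G.orbitSetoid_arc _ y)
      · exact G.vertexSetoid_le (G.orbitSetoid_apply _ y)
    · exact G.vertexSetoid_le (G.orbitSetoid_apply flipSide (x.1.1, x.2))
  boundarySetoid_le := by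
    have hb : G.bcol ≤ G.bcol ⊔ G.mergeSetoid A := le_sup_left
    have hm : G.mergeSetoid A ≤ G.bcol ⊔ G.mergeSetoid A := le_sup_right
    refine orbitSetoid_le _ (fun x => ?_) fun x => ?_
    · refine G.returnCorner_rel .deletion A (G.bcol ⊔ G.mergeSetoid A) (fun y => ?_) (fun y hy => ?_)
        (x.1.1, x.2) x.1.2
      · exact hb (G.boundarySetoid_le (G.orbitSetoid_arc _ y))
      · exact hm (Relation.EqvGen.rel _ _ ⟨y, _, rfl, rfl, hy, rfl⟩)
    · exact hb (G.boundarySetoid_le (G.orbitSetoid_apply flipEnd (x.1.1, x.2)))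

/-- `G / A`. The boundary components keep their colours. For each edge of `A`, the colour classes of
its end vertices are merged, and the vertices that arise are in the resulting class. -/
noncomputable def contract (A : Set G.E) : ColouredRibbonGraph.{u} where
  toRibbonGraph := G.toRibbonGraph.minor .contraction A
  vcol := Setoid.comap (G.minorPlace .contraction A) (G.vcol ⊔ G.mergeSetoid A)
  bcol := Setoid.comap (G.minorPlace .contraction A) G.bcol
  vertexSetoid_le := by
    have hb : G.vcol ≤ G.vcol ⊔ G.mergeSetoid A := le_sup_left
    have hm : G.mergeSetoid A ≤ G.vcol ⊔ G.mergeSetoid A := le_sup_right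
    refine orbitSetoid_le _ (fun x => ?_) fun x => ?_
    · refine G.returnCorner_rel .contraction A (G.vcol ⊔ G.mergeSetoid A) (fun y => ?_) (fun y hy => ?_)
        (x.1.1, x.2) x.1.2
      · exact hb (G.vertexSetoid_le (G.orbitSetoid_arc _ y))
      · exact hm (Relation.EqvGen.rel _ _ ⟨y, _, rfl, rfl, hy, rfl⟩)
    · exact hb (G.vertexSetoid_le (G.orbitSetoid_apply flipSide (x.1.1, x.2)))
  boundarySetoid_le := by
    refine orbitSetoid_le _ (fun x => ?_) fun x => ?_
    · refine G.returnCorner_rel .contraction A G.bcol (fun y => ?_) (fun y _ => ?_) (x.1.1, x.2)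
        x.1.2
      · exact G.boundarySetoid_le (G.orbitSetoid_arc _ y)
      · exact G.boundarySetoid_le (G.orbitSetoid_apply _ y)
    · exact G.boundarySetoid_le (G.orbitSetoid_apply flipEnd (x.1.1, x.2))

/-- The coloured ribbon graph obtained by disregarding the isolated vertices. -/
def dropIsolated : ColouredRibbonGraph.{u} where
  E := G.E
  K := PEmpty
  finite_E := G.finite_E
  finite_K := inferInstance
  arc := G.arc
  arc_arc := G.arc_arc
  arc_ne := G.arc_ne
  vcol := Setoid.comap (Sum.map id PEmpty.elim) G.vcol
  bcol := Setoid.comap (Sum.map id PEmpty.elim) G.bcol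
  vertexSetoid_le := orbitSetoid_le _ (fun x => G.vertexSetoid_le (G.orbitSetoid_arc _ x))
    fun x => G.vertexSetoid_le (G.orbitSetoid_apply _ x)
  boundarySetoid_le := orbitSetoid_le _ (fun x => G.boundarySetoid_le (G.orbitSetoid_arc _ x))
    fun x => G.boundarySetoid_le (G.orbitSetoid_apply _ x)

/-- Equivalence of coloured ribbon graphs: there are bijections of the corners and of the isolated
vertices that preserve the ends, free sides and free arcs and the colour classes of vertices and of boundary
components. (Orientation-reversing equivalences are included.) -/
def Equivalent (G H : ColouredRibbonGraph.{u}) : Prop :=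
  ∃ (c : Corner G.E ≃ Corner H.E) (k : G.K ≃ H.K),
    (∀ x, c (flipSide x) = flipSide (c x)) ∧
    (∀ x, c (flipEnd x) = flipEnd (c x)) ∧
    (∀ x, c (G.arc x) = H.arc (c x)) ∧
    (∀ p q, G.vcol p q ↔ H.vcol (Sum.map c k p) (Sum.map c k q)) ∧
    (∀ p q, G.bcol p q ↔ H.bcol (Sum.map c k p) (Sum.map c k q))

end ColouredRibbonGraph

/-- The connected coloured ribbon graphs on one edge: bridge in a surface, bridge in a pseudo-surface,
orientable loop (cellular), orientable loop (handle), non-orientable loop. -/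
inductive EdgeKind
  | bs
  | bp
  | olc
  | olh
  | nl

namespace EdgeKind

/-- The ribbon graph with one edge (and no isolated vertex) of the given kind. For a bridge each
vertex disc has one free arc, joining the corners of one end; for an orientable loop the free arcs
join the ends of the same free side, so that there are two boundary components (an annulus); for a
non-orientable loop they join the ends of different free sides (a Möbius band). -/
def ribbonGraph (i : EdgeKind) : RibbonGraph.{u} where
  E := PUnit
  K := PEmpty
  finite_E := inferInstance
  finite_K := inferInstance
  arc := match i with
    | bs | bp => flipSide
    | olc | olh => flipEnd
    | nl => fun x => flipEnd (flipSide x)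
  arc_arc x := by cases i <;> simp [flipSide, flipEnd]
  arc_ne x := by
    obtain ⟨e, a, b⟩ := x
    cases i <;> simp [flipSide, flipEnd]

/-- The coloured ribbon graph of the given kind. The vertices have distinct colours in `bs` and the
same colour in `bp`; the boundary components have distinct colours in `olc` and the same colour in `olh`. -/
def graph (i : EdgeKind) : ColouredRibbonGraph.{u} where
  toRibbonGraph := i.ribbonGraph
  vcol := match i with
    | bs => (ribbonGraph bs).vertexSetoid
    | bp | olc | olh | nl => ⊤
  bcol := match i with
    | olc => (ribbonGraph olc).boundarySetoid
    | bs | bp | olh | nl => ⊤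
  vertexSetoid_le := by cases i <;> first | exact le_rfl | exact le_top
  boundarySetoid_le := by cases i <;> first | exact le_rfl | exact le_top

end EdgeKind

namespace ColouredRibbonGraph

/-- The edge `e` of `G` is of type `(i, j)`: disregarding isolated vertices, the pair `(G / eᶜ, G \ eᶜ)`
is `(i, j)` up to equivalence, where `eᶜ` is the set of edges other than `e`. -/
def HasType (G : ColouredRibbonGraph.{u}) (e : G.E) (i j : EdgeKind) : Prop :=
  (G.contract {e}ᶜ).dropIsolated.Equivalent i.graph ∧
    (G.delete {e}ᶜ).dropIsolated.Equivalent j.graph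

end ColouredRibbonGraph

/-- The indeterminates; those with the suffix `Half` stand for square roots. -/
inductive UVar
  | alpha
  | beta
  | gamma
  | aBs
  | aBpHalf
  | aOlc
  | aOlhHalf
  | bBs
  | bBpHalf
  | bOlc
  | bOlhHalf

/-- The ring `ℤ[α, β, γ, a_bs, a_bp^{1/2}, a_olc, a_olh^{1/2}, b_bs, b_bp^{1/2}, b_olc, b_olh^{1/2}]`. -/
abbrev UPoly : Type := MvPolynomial UVar ℤ

/-- The coefficients `a_i`, with `a_nl = a_bp^{1/2} a_olh^{1/2}`. -/
noncomputable def coeffA : EdgeKind → UPoly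
  | .bs => MvPolynomial.X .aBs
  | .bp => MvPolynomial.X .aBpHalf ^ 2
  | .olc => MvPolynomial.X .aOlc
  | .olh => MvPolynomial.X .aOlhHalf ^ 2
  | .nl => MvPolynomial.X .aBpHalf * MvPolynomial.X .aOlhHalf

/-- The coefficients `b_j`, with `b_nl = b_bp^{1/2} b_olh^{1/2}`. -/
noncomputable def coeffB : EdgeKind → UPoly
  | .bs => MvPolynomial.X .bBs
  | .bp => MvPolynomial.X .bBpHalf ^ 2
  | .olc => MvPolynomial.X .bOlc
  | .olh => MvPolynomial.X .bOlhHalf ^ 2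
  | .nl => MvPolynomial.X .bBpHalf * MvPolynomial.X .bOlhHalf

/-- The deletion-contraction relations. -/
structure IsDeletionContraction (U : ColouredRibbonGraph.{u} → UPoly) : Prop where
  edge : ∀ (G : ColouredRibbonGraph.{u}) (e : G.E) (i j : EdgeKind), G.HasType e i j →
    U G = coeffA i * U (G.delete {e}) + coeffB j * U (G.contract {e})
  edgeless : ∀ G : ColouredRibbonGraph.{u}, IsEmpty G.E →
    U G = MvPolynomial.X .alpha ^ G.numVertexColours * MvPolynomial.X .beta ^ G.numBoundaryColours *
      MvPolynomial.X .gamma ^ G.numVertices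

/-! The function is an explicit sum over states. A state is a set `A` of edges, those to be
contracted, while the others are deleted. Its numbers of vertices, vertex colours and boundary
colours can be read off from `G` without processing edges in any order: the vertices are the
boundary components of the spanning subgraph on `A`, the vertex colours are merged along `A`, and
the boundary colours are merged along `Aᶜ`. Taking a minor first and then a state of it gives the
counts of a state of `G` (`delete_stateVec`, `contract_stateVec`).

The crux is that the product of the coefficients is also independent of the order. On a one-edge
graph, the kind fixes the difference of `stateVec` between deleting and contracting the edge
(`IsKind.stateVec_eq`). The difference vectors of the five kinds satisfy 2 nl = bp + olh, which is
the relation imposed on the coefficients, so a homomorphism from vectors to monomials sends each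
kind to its coefficient (`weightA_vec`, `weightB_vec`). The type of `e` in `G` compares the states
`{e}ᶜ` and `univ`, and the states `∅` and `{e}`. The weights of a state `A` are therefore taken at
`stateVec A - stateVec univ` and `stateVec ∅ - stateVec A`; removing one edge splits off exactly
`a_i` or `b_j`, and separating the states by whether they contain `e` gives the recursion
(`HasType.stateSum_eq`).

Exponents of differences are integers that might be negative, so the sum lives in the field of
fractions. As each edge has a type (`exists_hasType`), induction on the number of edges shows both
that the sum is a polynomial and that a solution is unique. -/

/-! ### Places of a minor compared with places of the original graph -/

/-- Choose for each `q` a `g q` with `f (g q)` in the `S`-class of `q`. Pulling `T'` back along `g`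
gives a relation containing all generators of `T`, hence `T` itself; so `f` is injective on classes.
It is the common tool for the counts in minors, with `S` the moves past removed edges. -/
lemma card_quotient_eq_of_generated {P Q : Type*} (f : P → Q) (S T : Setoid Q) (T' : Setoid P)
    (hST : S ≤ T) (hsurj : ∀ q, ∃ p, S q (f p)) (hcomap : Setoid.comap f S ≤ T')
    (hT' : T' ≤ Setoid.comap f T)
    (hleast : ∀ U : Setoid Q, S ≤ U → (∀ p q, T' p q → U (f p) (f q)) → T ≤ U) :
    Nat.card (Quotient T') = Nat.card (Quotient T) := by
  choose g hg using hsurj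
  have hTU : T ≤ Setoid.comap g T' := by
    refine hleast _ (fun a b hab => ?_) fun p q hpq => ?_
    · exact hcomap (S.trans (S.symm (hg a)) (S.trans hab (hg b)))
    · exact T'.trans (T'.symm (hcomap (hg (f p)))) (T'.trans hpq (hcomap (hg (f q))))
  refine Nat.card_congr (Equiv.ofBijective
    (Quotient.map' f fun p q h => hT' h) ⟨?_, ?_⟩)
  · rintro ⟨p⟩ ⟨q⟩ h
    have h1 : T (f p) (f q) := Quotient.exact h
    exact Quotient.sound (T'.trans (hcomap (hg (f p)))
      (T'.trans (hTU h1) (T'.symm (hcomap (hg (f q))))))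
  · rintro ⟨q⟩
    exact ⟨Quotient.mk _ (g q), Quotient.sound (T.symm (hST (hg q)))⟩

namespace RibbonGraph

variable (G : RibbonGraph.{u})

lemma mergeSetoid_le {A : Set G.E} {S : Setoid G.Place}
    (h : ∀ x y : Corner G.E, x.1 ∈ A → x.1 = y.1 → S (Sum.inl x) (Sum.inl y)) :
    G.mergeSetoid A ≤ S := by
  intro p q hpq
  induction hpq with
  | rel p q h' =>
    obtain ⟨x, y, rfl, rfl, h1, h2⟩ := h'
    exact h x y h1 h2
  | refl p => exact S.refl p
  | symm p q _ ih => exact S.symm ih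
  | trans p q r _ _ ih1 ih2 => exact S.trans ih1 ih2

lemma mergeSetoid_apply {A : Set G.E} {x y : Corner G.E} (hx : x.1 ∈ A) (h : x.1 = y.1) :
    G.mergeSetoid A (Sum.inl x) (Sum.inl y) :=
  Relation.EqvGen.rel _ _ ⟨x, y, rfl, rfl, hx, h⟩

lemma mergeSetoid_union (A B : Set G.E) :
    G.mergeSetoid (A ∪ B) = G.mergeSetoid A ⊔ G.mergeSetoid B := by
  apply le_antisymm
  · refine G.mergeSetoid_le fun x y hx h => ?_
    have h1 : G.mergeSetoid A ≤ G.mergeSetoid A ⊔ G.mergeSetoid B := le_sup_left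
    have h2 : G.mergeSetoid B ≤ G.mergeSetoid A ⊔ G.mergeSetoid B := le_sup_right
    rcases hx with hx | hx
    · exact h1 (G.mergeSetoid_apply hx h)
    · exact h2 (G.mergeSetoid_apply hx h)
  · exact sup_le (G.mergeSetoid_le fun x y hx h => G.mergeSetoid_apply (Or.inl hx) h)
      (G.mergeSetoid_le fun x y hx h => G.mergeSetoid_apply (Or.inr hx) h)

lemma mergeSetoid_empty : G.mergeSetoid ∅ = ⊥ :=
  le_bot_iff.1 (G.mergeSetoid_le fun _ _ hx => hx.elim)

lemma turn_empty (m : MinorOp) : G.turn m ∅ = flipSide := by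
  funext x; simp [turn]

lemma turn_contraction_univ : G.turn .contraction Set.univ = flipEnd := by
  funext x; simp [turn, cross]

/-- The corners met on the walk from a remaining corner until it returns to a remaining edge exhaust
the corners that can be reached by moving along free arcs and passing removed edges. -/
lemma eq_or_eq_returnCorner (m : MinorOp) (B : Set G.E) (x : Corner G.E) (hx : x.1 ∉ B)
    (p : G.Place) (h : G.orbitSetoid (G.pass m B) (Sum.inl x) p) :
    ∃ y, p = Sum.inl y ∧ (y.1 ∉ B → y = x ∨ y = G.returnCorner m B x hx) := by
  classical
  set k := G.returnTime m B x hx with hk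
  have hlt : ∀ j, j < k → ((G.walk m B ^ (j + 1)) x).1 ∈ B := fun j hj => by
    have := Nat.find_min (G.exists_return m B x hx) hj
    simpa using this
  have hend : ((G.walk m B ^ (k + 1)) x).1 ∉ B := G.returnCorner_fst m B x hx
  have hpass : ∀ y : Corner G.E, y.1 ∉ B → G.pass m B y = y := fun y hy => by simp [pass, hy]
  have hstep : ∀ j, G.arc (G.pass m B ((G.walk m B ^ j) x)) = (G.walk m B ^ (j + 1)) x := fun j => by
    rw [pow_succ', Equiv.Perm.mul_apply]; rfl
  have hback : ∀ j, G.arc ((G.walk m B ^ (j + 1)) x) = G.pass m B ((G.walk m B ^ j) x) := fun j => by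
    rw [← hstep, G.arc_arc]
  -- The corners met on the walk, before and after passing. The set is closed under `arc` because
  -- passing fixes both ends of the walk: they lie on remaining edges.
  let W : Set (Corner G.E) := {y | ∃ j ≤ k + 1,
    y = (G.walk m B ^ j) x ∨ y = G.pass m B ((G.walk m B ^ j) x)}
  have harc : ∀ y ∈ W, G.arc y ∈ W := by
    rintro y ⟨j, hj, rfl | rfl⟩
    · rcases j with _ | j
      · refine ⟨1, by omega, Or.inl ?_⟩
        rw [← hstep, pow_zero, Equiv.Perm.one_apply, hpass x hx]
      · exact ⟨j, by omega, Or.inr (hback j)⟩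
    · rcases Nat.lt_or_ge j (k + 1) with h | h
      · exact ⟨j + 1, by omega, Or.inl (hstep j)⟩
      · obtain rfl : j = k + 1 := by omega
        rw [hpass _ hend, hback]
        exact ⟨k, by omega, Or.inr rfl⟩
  have hpassW : ∀ y ∈ W, G.pass m B y ∈ W := by
    rintro y ⟨j, hj, rfl | rfl⟩
    · exact ⟨j, hj, Or.inr rfl⟩
    · exact ⟨j, hj, Or.inl (G.pass_pass _ _ _)⟩
  have hmem : ∀ p q, G.orbitSetoid (G.pass m B) p q → ((∃ y ∈ W, p = Sum.inl y) ↔ ∃ y ∈ W, q = Sum.inl y) := by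
    intro p q h
    induction h with
    | rel p q h =>
      obtain ⟨y, rfl, rfl | rfl⟩ := h
      · simp only [Sum.inl.injEq, exists_eq_right']
        refine ⟨harc y, fun h => ?_⟩
        simpa [G.arc_arc] using harc _ h
      · simp only [Sum.inl.injEq, exists_eq_right']
        refine ⟨hpassW y, fun h => ?_⟩
        simpa [G.pass_pass] using hpassW _ h
    | refl p => rfl
    | symm p q _ ih => exact ih.symm
    | trans p q r _ _ ih1 ih2 => exact ih1.trans ih2
  obtain ⟨y, ⟨j, hj, hy⟩, rfl⟩ := (hmem _ _ h).1 ⟨x, ⟨0, by omega, Or.inl rfl⟩, rfl⟩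
  refine ⟨y, rfl, fun hyB => ?_⟩
  have hj1 : ((G.walk m B ^ j) x).1 ∉ B := by
    rcases hy with rfl | rfl
    · exact hyB
    · rwa [pass_fst] at hyB
  have hy' : y = (G.walk m B ^ j) x := by
    rcases hy with hy | hy
    · exact hy
    · rw [hy, hpass _ hj1]
  rcases j with _ | j
  · exact Or.inl hy'
  · rcases Nat.lt_or_ge j k with h | h
    · exact (hj1 (hlt j h)).elim
    · obtain rfl : j = k := by omega
      exact Or.inr hy'

lemma orbitSetoid_pass_le (m : MinorOp) (B : Set G.E) :
    G.orbitSetoid (G.pass m B) ≤ G.minorVertexSetoid m B := by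
  refine G.orbitSetoid_le (fun x => G.orbitSetoid_arc _ x) fun x => ?_
  by_cases h : x.1 ∈ B
  · have := G.orbitSetoid_apply (G.turn m B) x
    simp only [turn, h, if_true] at this
    simp only [pass, h, if_true]
    exact this
  · simp only [pass, h, if_false]
    exact (G.minorVertexSetoid m B).refl _

/-- Each place of `G` reaches a place of the minor by moving along free arcs and passing removed
edges. -/
lemma exists_minorPlace (m : MinorOp) (B : Set G.E) (q : G.Place) :
    ∃ p, G.orbitSetoid (G.pass m B) q (G.minorPlace m B p) := by
  classical
  set S := G.orbitSetoid (G.pass m B) with hS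
  let good : G.Place → Prop := fun q => ∃ y : Corner G.E, y.1 ∉ B ∧ S q (Sum.inl y)
  -- The moves `turn` and `pass` differ only at remaining edges. So a chain round a vertex disc is
  -- either a chain of passes or has both ends linked by passes to remaining corners. A place with
  -- no such link lies on an isolated vertex of the minor.
  have key : ∀ p q, G.minorVertexSetoid m B p q → S p q ∨ (good p ∧ good q) := by
    intro p q h
    induction h with
    | rel p q h =>
      obtain ⟨x, rfl, rfl | rfl⟩ := h
      · exact Or.inl (G.orbitSetoid_arc _ x)
      · by_cases hx : x.1 ∈ B
        · have := G.orbitSetoid_apply (G.pass m B) x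
          left
          simpa [pass, turn, hx] using this
        · refine Or.inr ⟨⟨x, hx, S.refl _⟩, ⟨G.turn m B x, ?_, S.refl _⟩⟩
          simp [turn, hx, flipSide]
    | refl p => exact Or.inl (S.refl p)
    | symm p q _ ih => exact ih.imp S.symm And.symm
    | trans p q r _ _ ih1 ih2 =>
      rcases ih1 with h1 | ⟨h1, h2⟩
      · rcases ih2 with h3 | ⟨⟨y, hy, h3⟩, h4⟩
        · exact Or.inl (S.trans h1 h3)
        · exact Or.inr ⟨⟨y, hy, S.trans h1 h3⟩, h4⟩
      · rcases ih2 with h3 | ⟨_, h4⟩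
        · obtain ⟨y, hy, h2⟩ := h2
          exact Or.inr ⟨h1, y, hy, S.trans (S.symm h3) h2⟩
        · exact Or.inr ⟨h1, h4⟩
  by_cases hq : good q
  · obtain ⟨y, hy, h⟩ := hq
    exact ⟨Sum.inl (⟨y.1, hy⟩, y.2), h⟩
  · have hv : ∀ x : Corner G.E, Quotient.mk (G.minorVertexSetoid m B) (Sum.inl x) =
        Quotient.mk (G.minorVertexSetoid m B) q → x.1 ∈ B := by
      intro x hx
      by_contra hxB
      rcases key _ _ (@Quotient.exact _ (G.minorVertexSetoid m B) _ _ hx) with h | h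
      · exact hq ⟨x, hxB, S.symm h⟩
      · exact hq h.2
    refine ⟨Sum.inr ⟨_, hv⟩, ?_⟩
    have h1 : G.minorVertexSetoid m B q (Quotient.mk (G.minorVertexSetoid m B) q).out :=
      (G.minorVertexSetoid m B).symm (Quotient.mk_out (s := G.minorVertexSetoid m B) q)
    exact (key _ _ h1).resolve_right fun h => hq h.1

/-- A pass orbit contains either remaining corners, at most two and then joined by a free arc of the
minor, or the place of an isolated vertex; both at once would contradict isolation. The arcs of the
minor thus account for the whole induced relation. -/
lemma comap_orbitSetoid_pass_le (m : MinorOp) (B : Set G.E) {T : Setoid (G.minor m B).Place}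
    (h : ∀ x, T (Sum.inl x) (Sum.inl ((G.minor m B).arc x))) :
    Setoid.comap (G.minorPlace m B) (G.orbitSetoid (G.pass m B)) ≤ T := by
  have mixed : ∀ (x : Corner (G.minor m B).E) (v : (G.minor m B).K),
      ¬ G.orbitSetoid (G.pass m B) (G.minorPlace m B (Sum.inl x)) (G.minorPlace m B (Sum.inr v)) := by
    intro x v hxv
    refine x.1.2 (v.2 (x.1.1, x.2) ?_)
    rw [← Quotient.out_eq v.1]
    exact Quotient.sound (G.orbitSetoid_pass_le m B hxv)
  rintro (x | v) (y | w) hpq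
  · obtain ⟨⟨x, hx⟩, x'⟩ := x
    obtain ⟨⟨y, hy⟩, y'⟩ := y
    obtain ⟨z, hz, h'⟩ := G.eq_or_eq_returnCorner m B (x, x') hx _ hpq
    obtain rfl : (y, y') = z := Sum.inl.inj hz
    rcases h' hy with h' | h'
    · obtain ⟨rfl, rfl⟩ := Prod.mk.inj h'
      exact T.refl _
    · have : ((⟨y, hy⟩, y') : Corner (G.minor m B).E) = (G.minor m B).arc (⟨x, hx⟩, x') :=
        Prod.ext (Subtype.ext (congrArg (fun z => z.1) h')) (congrArg (fun z => z.2) h')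
      rw [this]
      exact h _
  · exact (mixed _ _ hpq).elim
  · exact (mixed _ _ ((G.orbitSetoid (G.pass m B)).symm hpq)).elim
  · have : v.1 = w.1 := by
      rw [← Quotient.out_eq v.1, ← Quotient.out_eq w.1]
      exact Quotient.sound (G.orbitSetoid_pass_le m B hpq)
    obtain rfl : v = w := Subtype.ext this
    exact T.refl _

lemma orbitSetoid_minor_arc (m : MinorOp) (B : Set G.E) (x : Corner (G.minor m B).E) :
    G.orbitSetoid (G.pass m B) (G.minorPlace m B (Sum.inl x))
      (G.minorPlace m B (Sum.inl ((G.minor m B).arc x))) := by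
  refine G.returnCorner_rel m B _ (G.orbitSetoid_arc _) (fun y hy => ?_) (x.1.1, x.2) x.1.2
  have := G.orbitSetoid_apply (G.pass m B) y
  simpa [pass, hy] using this

/-- Used for both colourings. Since `S` already absorbs the passes along `B`, every `S`-class
contains a place of the minor, and merging along `D` means the same upstairs and downstairs. -/
lemma card_quotient_minor_merge (m : MinorOp) (B : Set G.E) (S : Setoid G.Place)
    (hS : G.orbitSetoid (G.pass m B) ≤ S) (D : Set (G.minor m B).E) :
    Nat.card (Quotient (Setoid.comap (G.minorPlace m B) S ⊔ (G.minor m B).mergeSetoid D)) =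
      Nat.card (Quotient (S ⊔ G.mergeSetoid (Subtype.val '' D))) := by
  have hl : S ≤ S ⊔ G.mergeSetoid (Subtype.val '' D) := le_sup_left
  have hr : G.mergeSetoid (Subtype.val '' D) ≤ S ⊔ G.mergeSetoid (Subtype.val '' D) := le_sup_right
  refine card_quotient_eq_of_generated (G.minorPlace m B) S _ _ hl (fun q => ?_) le_sup_left
    (sup_le (fun p q h => hl h) ?_) fun U hU h => sup_le hU ?_
  · exact (G.exists_minorPlace m B q).imp fun p hp => hS hp
  · refine (G.minor m B).mergeSetoid_le fun x y hx hxy => hr ?_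
    exact G.mergeSetoid_apply ⟨x.1, hx, rfl⟩ (congrArg Subtype.val hxy)
  · refine G.mergeSetoid_le ?_
    rintro ⟨_, x⟩ ⟨_, y⟩ ⟨e, he, rfl⟩ hxy
    obtain rfl := hxy
    refine h (Sum.inl (e, x)) (Sum.inl (e, y)) ?_
    have hr' : (G.minor m B).mergeSetoid D ≤
      Setoid.comap (G.minorPlace m B) S ⊔ (G.minor m B).mergeSetoid D := le_sup_right
    exact hr' ((G.minor m B).mergeSetoid_apply he rfl)

/-- `A` is the set of edges of `G` along which the vertex discs are joined when the edges of `B` are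
removed by `m` and the edges of `C` are contracted. -/
lemma card_quotient_minorVertexSetoid_minor (m : MinorOp) (B A : Set G.E) (C : Set (G.minor m B).E)
    (hB : ∀ x : Corner G.E, x.1 ∈ B → G.turn .contraction A x = cross m x)
    (hC : ∀ e : (G.minor m B).E, e.1 ∈ A ↔ e ∈ C) :
    Nat.card (Quotient ((G.minor m B).minorVertexSetoid .contraction C)) =
      Nat.card (Quotient (G.minorVertexSetoid .contraction A)) := by
  classical
  have hturn : ∀ x : Corner (G.minor m B).E,
      G.minorPlace m B (Sum.inl ((G.minor m B).turn .contraction C x)) =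
        Sum.inl (G.turn .contraction A (x.1.1, x.2)) := by
    rintro ⟨e, x⟩
    by_cases h : e ∈ C
    · simp [turn, h, (hC e).2 h, minorPlace, cross, flipEnd]
    · simp [turn, h, (hC e).not.2 h, minorPlace, flipSide]
  -- By `hB`, the turn for `A` agrees with the pass at the edges of `B`, so pass orbits stay on one
  -- vertex of the state.
  have hle : G.orbitSetoid (G.pass m B) ≤ G.minorVertexSetoid .contraction A := by
    refine G.orbitSetoid_le (G.orbitSetoid_arc _) fun x => ?_
    by_cases h : x.1 ∈ B
    · have := G.orbitSetoid_apply (G.turn .contraction A) x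
      rw [hB x h] at this
      simp only [pass, h, if_true]
      exact this
    · simp only [pass, h, if_false]
      exact (G.minorVertexSetoid .contraction A).refl _
  refine card_quotient_eq_of_generated (G.minorPlace m B) _ _ _ hle (G.exists_minorPlace m B)
    (G.comap_orbitSetoid_pass_le m B ((G.minor m B).orbitSetoid_arc _))
    ((G.minor m B).orbitSetoid_le (fun x => hle (G.orbitSetoid_minor_arc m B x)) fun x => ?_)
    fun U hU h => G.orbitSetoid_le (fun x => hU (G.orbitSetoid_arc _ x)) fun x => ?_
  · change G.minorVertexSetoid .contraction A (G.minorPlace m B _) (G.minorPlace m B _)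
    rw [hturn]
    exact G.orbitSetoid_apply _ _
  · by_cases hx : x.1 ∈ B
    · rw [hB x hx]
      have := hU (G.orbitSetoid_apply (G.pass m B) x)
      simpa [pass, hx] using this
    · have := h _ _ ((G.minor m B).orbitSetoid_apply ((G.minor m B).turn .contraction C)
        (⟨x.1, hx⟩, x.2))
      rwa [hturn] at this

end RibbonGraph

/-! ### States of a minor as states of the original graph -/

lemma compl_image_val {α : Type*} {B : Set α} (C : Set {a // a ∉ B}) :
    (Subtype.val '' C)ᶜ = B ∪ Subtype.val '' Cᶜ := by
  ext a
  by_cases ha : a ∈ B <;> simp [ha]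

lemma compl_union_image_val {α : Type*} {B : Set α} (C : Set {a // a ∉ B}) :
    (B ∪ Subtype.val '' C)ᶜ = Subtype.val '' Cᶜ := by
  rw [← compl_compl C, ← compl_image_val, compl_compl, compl_compl]

namespace ColouredRibbonGraph

open RibbonGraph

variable (G : ColouredRibbonGraph.{u})

/-- The number of vertices after contracting the edges of `A` and deleting the others. -/
noncomputable def stateVertices (A : Set G.E) : ℕ :=
  Nat.card (Quotient (G.minorVertexSetoid .contraction A))

/-- The number of vertex colour classes after contracting the edges of `A` and deleting the others. -/
noncomputable def stateVertexColours (A : Set G.E) : ℕ :=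
  Nat.card (Quotient (G.vcol ⊔ G.mergeSetoid A))

/-- The number of boundary colour classes after contracting the edges of `A` and deleting the
others. -/
noncomputable def stateBoundaryColours (A : Set G.E) : ℕ :=
  Nat.card (Quotient (G.bcol ⊔ G.mergeSetoid Aᶜ))

lemma delete_stateVertices (B : Set G.E) (C : Set (G.delete B).E) :
    (G.delete B).stateVertices C = G.stateVertices (Subtype.val '' C) := by
  refine G.card_quotient_minorVertexSetoid_minor .deletion B _ C (fun x hx => ?_) fun e => ?_
  · have : x.1 ∉ Subtype.val '' C := by
      rintro ⟨e, _, he⟩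
      exact e.2 (he ▸ hx)
    simp [turn, this, cross]
  · exact Subtype.val_injective.mem_set_image

lemma contract_stateVertices (B : Set G.E) (C : Set (G.contract B).E) :
    (G.contract B).stateVertices C = G.stateVertices (B ∪ Subtype.val '' C) := by
  refine G.card_quotient_minorVertexSetoid_minor .contraction B _ C (fun x hx => ?_) fun e => ?_
  · have : x.1 ∈ B ∪ Subtype.val '' C := Or.inl hx
    simp [turn, this]
  · constructor
    · rintro (h | h)
      · exact (e.2 h).elim
      · exact Subtype.val_injective.mem_set_image.1 h
    · exact fun h => Or.inr ⟨e, h, rfl⟩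

/-- Passing a deleted edge along its end does not leave the vertex, so deletion requires no merging
of vertex colours. -/
lemma orbitSetoid_pass_deletion_le_vcol (B : Set G.E) :
    G.orbitSetoid (G.pass .deletion B) ≤ G.vcol := by
  refine G.orbitSetoid_le (fun x => G.vertexSetoid_le (G.orbitSetoid_arc _ x)) fun x => ?_
  unfold RibbonGraph.pass
  split_ifs
  · exact G.vertexSetoid_le (G.orbitSetoid_apply _ x)
  · exact G.vcol.refl _

lemma orbitSetoid_pass_contraction_le_bcol (B : Set G.E) :
    G.orbitSetoid (G.pass .contraction B) ≤ G.bcol := by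
  refine G.orbitSetoid_le (fun x => G.boundarySetoid_le (G.orbitSetoid_arc _ x)) fun x => ?_
  unfold RibbonGraph.pass
  split_ifs
  · exact G.boundarySetoid_le (G.orbitSetoid_apply _ x)
  · exact G.bcol.refl _

/-- A pass may leave the `S`-class, but it stays on one edge of `B`, all of whose corners have been
merged. -/
lemma orbitSetoid_pass_le_sup_mergeSetoid (m : MinorOp) (B : Set G.E) (S : Setoid G.Place)
    (hS : ∀ x, S (Sum.inl x) (Sum.inl (G.arc x))) :
    G.orbitSetoid (G.pass m B) ≤ S ⊔ G.mergeSetoid B := by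
  have hl : S ≤ S ⊔ G.mergeSetoid B := le_sup_left
  have hr : G.mergeSetoid B ≤ S ⊔ G.mergeSetoid B := le_sup_right
  refine G.orbitSetoid_le (fun x => hl (hS x)) fun x => ?_
  unfold RibbonGraph.pass
  split_ifs with h
  · exact hr (G.mergeSetoid_apply h (cross_fst m x).symm)
  · exact (S ⊔ G.mergeSetoid B).refl _

lemma delete_stateVertexColours (B : Set G.E) (C : Set (G.delete B).E) :
    (G.delete B).stateVertexColours C = G.stateVertexColours (Subtype.val '' C) :=
  G.card_quotient_minor_merge .deletion B _ (G.orbitSetoid_pass_deletion_le_vcol B) C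

lemma contract_stateVertexColours (B : Set G.E) (C : Set (G.contract B).E) :
    (G.contract B).stateVertexColours C = G.stateVertexColours (B ∪ Subtype.val '' C) := by
  unfold stateVertexColours
  rw [mergeSetoid_union, ← sup_assoc]
  exact G.card_quotient_minor_merge .contraction B _ (G.orbitSetoid_pass_le_sup_mergeSetoid _ B _
    fun x => G.vertexSetoid_le (G.orbitSetoid_arc _ x)) C

lemma delete_stateBoundaryColours (B : Set G.E) (C : Set (G.delete B).E) :
    (G.delete B).stateBoundaryColours C = G.stateBoundaryColours (Subtype.val '' C) := by
  have h : (Subtype.val '' C)ᶜ = B ∪ Subtype.val '' Cᶜ := compl_image_val C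
  unfold stateBoundaryColours
  rw [h, mergeSetoid_union, ← sup_assoc]
  exact G.card_quotient_minor_merge .deletion B _ (G.orbitSetoid_pass_le_sup_mergeSetoid _ B _
    fun x => G.boundarySetoid_le (G.orbitSetoid_arc _ x)) Cᶜ

lemma contract_stateBoundaryColours (B : Set G.E) (C : Set (G.contract B).E) :
    (G.contract B).stateBoundaryColours C = G.stateBoundaryColours (B ∪ Subtype.val '' C) := by
  have h : (B ∪ Subtype.val '' C)ᶜ = Subtype.val '' Cᶜ := compl_union_image_val C
  unfold stateBoundaryColours
  rw [h]
  exact G.card_quotient_minor_merge .contraction B _ (G.orbitSetoid_pass_contraction_le_bcol B) Cᶜ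

end ColouredRibbonGraph

/-! ### One-edge coloured ribbon graphs -/

lemma card_quotient_eq_add_of_pair {Q : Type*} [Finite Q] (S T : Setoid Q) (a b : Q) (hST : S ≤ T)
    (hab : T a b) (hleast : ∀ U : Setoid Q, S ≤ U → U a b → T ≤ U) (hne : ¬ S a b) :
    Nat.card (Quotient S) = Nat.card (Quotient T) + 1 := by
  classical
  -- Relating everything in the union of the classes of `a` and `b` gives an equivalence relation;
  -- minimality puts `T` inside it.
  have hle : ∀ p q, T p q → S p q ∨ ((S p a ∨ S p b) ∧ (S q a ∨ S q b)) := by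
    let U : Setoid Q :=
      { r := fun p q => S p q ∨ ((S p a ∨ S p b) ∧ (S q a ∨ S q b))
        iseqv := by
          refine ⟨fun p => Or.inl (S.refl p), fun {p q} h => h.imp S.symm And.symm, ?_⟩
          rintro p q r (h | ⟨h1, h2⟩) (h' | ⟨h3, h4⟩)
          · exact Or.inl (S.trans h h')
          · exact Or.inr ⟨h3.imp (S.trans h) (S.trans h), h4⟩
          · exact Or.inr ⟨h1, h2.imp (S.trans (S.symm h')) (S.trans (S.symm h'))⟩
          · exact Or.inr ⟨h1, h4⟩ }
    exact fun p q h => hleast U (fun p q h => Or.inl h)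
      (Or.inr ⟨Or.inl (S.refl a), Or.inr (S.refl b)⟩) h
  -- With the class of `b` discarded, every `T`-class is represented exactly once, the glued one by
  -- the class of `a`.
  have e : {c : Quotient S // c ≠ Quotient.mk S b} ≃ Quotient T := by
    refine Equiv.ofBijective (fun c => Quotient.map' id (fun p q h => hST h) c.1) ⟨?_, ?_⟩
    · rintro ⟨⟨p⟩, hp⟩ ⟨⟨q⟩, hq⟩ h
      have h1 : T p q := Quotient.exact h
      have hp' : ¬ S p b := fun h => hp (Quotient.sound h)
      have hq' : ¬ S q b := fun h => hq (Quotient.sound h)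
      refine Subtype.ext (Quotient.sound ?_)
      rcases hle p q h1 with h | ⟨h2, h3⟩
      · exact h
      · exact S.trans (h2.resolve_right hp') (S.symm (h3.resolve_right hq'))
    · rintro ⟨p⟩
      by_cases hp : S p b
      · exact ⟨⟨Quotient.mk S a, fun h => hne (@Quotient.exact _ S _ _ h)⟩,
          Quotient.sound (T.trans hab (T.symm (hST hp)))⟩
      · exact ⟨⟨Quotient.mk S p, fun h => hp (@Quotient.exact _ S _ _ h)⟩, rfl⟩
  have : Nat.card (Quotient S) =
      Nat.card {c : Quotient S // c = Quotient.mk S b} + Nat.card {c : Quotient S // c ≠ Quotient.mk S b} := by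
    rw [← Nat.card_sum]
    exact Nat.card_congr (Equiv.sumCompl _).symm
  rw [this, Nat.card_congr e, Nat.card_unique, add_comm]

namespace Corner

variable {E : Type u}

lemma flipEnd_flipSide (x : Corner E) : flipEnd (flipSide x) = flipSide (flipEnd x) := rfl

lemma eq_flip_of_fst_eq {x y : Corner E} (h : x.1 = y.1) :
    y = x ∨ y = flipSide x ∨ y = flipEnd x ∨ y = flipEnd (flipSide x) := by
  obtain ⟨e, a, b⟩ := x
  obtain ⟨e', a', b'⟩ := y
  obtain rfl : e = e' := h
  cases a <;> cases b <;> cases a' <;> cases b' <;> simp [flipSide, flipEnd]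

/-- The two flips act transitively on the four corners of the only edge. When one flip always
preserves the class, a single link along the other joins all four. -/
lemma rel_of_rel_flipEnd [Subsingleton E] {P : Type*} (f : Corner E → P) (U : Setoid P)
    (h : ∀ x, U (f x) (f (flipSide x))) {x₀ : Corner E} (h₀ : U (f x₀) (f (flipEnd x₀)))
    (x y : Corner E) : U (f x) (f y) := by
  have key : ∀ y, U (f x₀) (f y) := fun y => by
    rcases eq_flip_of_fst_eq (Subsingleton.elim x₀.1 y.1) with rfl | rfl | rfl | rfl
    · exact U.refl _
    · exact h x₀
    · exact h₀
    · exact U.trans h₀ (h (flipEnd x₀))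
  exact U.trans (U.symm (key x)) (key y)

lemma rel_of_rel_flipSide [Subsingleton E] {P : Type*} (f : Corner E → P) (U : Setoid P)
    (h : ∀ x, U (f x) (f (flipEnd x))) {x₀ : Corner E} (h₀ : U (f x₀) (f (flipSide x₀)))
    (x y : Corner E) : U (f x) (f y) := by
  have key : ∀ y, U (f x₀) (f y) := fun y => by
    rcases eq_flip_of_fst_eq (Subsingleton.elim x₀.1 y.1) with rfl | rfl | rfl | rfl
    · exact U.refl _
    · exact h₀
    · exact h x₀
    · exact U.trans h₀ (h (flipSide x₀))
  exact U.trans (U.symm (key x)) (key y)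

end Corner

set_option synthInstance.maxSize 2000 in
set_option maxRecDepth 10000 in
-- Four points have three perfect matchings, here the three nonzero translations of (ℤ/2)².
lemma involution_eq_of_forall_ne : ∀ a : Bool × Bool → Bool × Bool, (∀ x, a (a x) = x) →
    (∀ x, a x ≠ x) → (∀ x, a x = (x.1, !x.2)) ∨ (∀ x, a x = (!x.1, x.2)) ∨
      ∀ x, a x = (!x.1, !x.2) := by
  decide

namespace RibbonGraph

variable (G : RibbonGraph.{u})

/-- The index of the end is invariant under both moves that generate the vertex relation, and it
separates the two corners. -/
lemma not_vertexSetoid_flipEnd (h : ∀ x, G.arc x = flipSide x) (x : Corner G.E) :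
    ¬ G.vertexSetoid (Sum.inl x) (Sum.inl (flipEnd x)) := by
  have hle : G.vertexSetoid ≤ Setoid.ker (Sum.elim (fun x : Corner G.E => x.2.1) fun _ => false) :=
    G.orbitSetoid_le (fun x => by rw [h]; rfl) fun x => rfl
  intro hx
  have : x.2.1 = !x.2.1 := hle hx
  simp at this

lemma not_boundarySetoid_flipSide (h : ∀ x, G.arc x = flipEnd x) (x : Corner G.E) :
    ¬ G.boundarySetoid (Sum.inl x) (Sum.inl (flipSide x)) := by
  have hle : G.boundarySetoid ≤
      Setoid.ker (Sum.elim (fun x : Corner G.E => x.2.2) fun _ => false) :=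
    G.orbitSetoid_le (fun x => by rw [h]; rfl) fun x => rfl
  intro hx
  have : x.2.2 = !x.2.2 := hle hx
  simp at this

end RibbonGraph

namespace ColouredRibbonGraph

open RibbonGraph

variable (X : ColouredRibbonGraph.{u})

lemma vcol_arc (x : Corner X.E) : X.vcol (Sum.inl x) (Sum.inl (X.arc x)) :=
  X.vertexSetoid_le (X.orbitSetoid_arc _ x)

lemma vcol_flipSide (x : Corner X.E) : X.vcol (Sum.inl x) (Sum.inl (flipSide x)) :=
  X.vertexSetoid_le (X.orbitSetoid_apply _ x)

lemma bcol_arc (x : Corner X.E) : X.bcol (Sum.inl x) (Sum.inl (X.arc x)) :=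
  X.boundarySetoid_le (X.orbitSetoid_arc _ x)

lemma bcol_flipEnd (x : Corner X.E) : X.bcol (Sum.inl x) (Sum.inl (flipEnd x)) :=
  X.boundarySetoid_le (X.orbitSetoid_apply _ x)

/-- The description of the kind of a one-edge coloured ribbon graph by its free arcs and colours. -/
def IsKind : EdgeKind → Prop
  | .bs => (∀ x, X.arc x = flipSide x) ∧ ∀ x, ¬ X.vcol (Sum.inl x) (Sum.inl (flipEnd x))
  | .bp => (∀ x, X.arc x = flipSide x) ∧ ∀ x, X.vcol (Sum.inl x) (Sum.inl (flipEnd x))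
  | .olc => (∀ x, X.arc x = flipEnd x) ∧ ∀ x, ¬ X.bcol (Sum.inl x) (Sum.inl (flipSide x))
  | .olh => (∀ x, X.arc x = flipEnd x) ∧ ∀ x, X.bcol (Sum.inl x) (Sum.inl (flipSide x))
  | .nl => ∀ x, X.arc x = flipEnd (flipSide x)

/-- The conditions in `IsKind` involve only corners, so isolated vertices play no role, and a
bijection that commutes with flips and arcs carries them over. -/
lemma isKind_of_equivalent {i : EdgeKind} (h : X.dropIsolated.Equivalent i.graph) : X.IsKind i := by
  obtain ⟨c, k, hs, he, ha, hv, hb⟩ := h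
  have hv' : ∀ x y : Corner X.E, X.vcol (Sum.inl x) (Sum.inl y) ↔
    i.graph.vcol (Sum.inl (c x)) (Sum.inl (c y)) := fun x y => hv (Sum.inl x) (Sum.inl y)
  have hb' : ∀ x y : Corner X.E, X.bcol (Sum.inl x) (Sum.inl y) ↔
    i.graph.bcol (Sum.inl (c x)) (Sum.inl (c y)) := fun x y => hb (Sum.inl x) (Sum.inl y)
  cases i with
  | bs =>
    refine ⟨fun x => c.injective ((ha x).trans (hs x).symm), fun x hx => ?_⟩
    rw [hv'] at hx
    have h1 := not_vertexSetoid_flipEnd (EdgeKind.ribbonGraph .bs) (fun _ => rfl) (c x)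
    exact h1 (he x ▸ hx)
  | bp =>
    exact ⟨fun x => c.injective ((ha x).trans (hs x).symm), fun x => (hv' _ _).2 trivial⟩
  | olc =>
    refine ⟨fun x => c.injective ((ha x).trans (he x).symm), fun x hx => ?_⟩
    rw [hb'] at hx
    have h1 := not_boundarySetoid_flipSide (EdgeKind.ribbonGraph .olc) (fun _ => rfl) (c x)
    exact h1 (hs x ▸ hx)
  | olh =>
    exact ⟨fun x => c.injective ((ha x).trans (he x).symm), fun x => (hb' _ _).2 trivial⟩
  | nl =>
    exact fun x => c.injective
      ((ha x).trans ((he (flipSide x)).trans (congrArg flipEnd (hs x))).symm)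

lemma equivalent_of_isKind [Unique X.E] {i : EdgeKind} (h : X.IsKind i) :
    X.dropIsolated.Equivalent i.graph := by
  let c : Corner X.E ≃ Corner PUnit.{u + 1} :=
    Equiv.prodCongr (Equiv.ofUnique X.E PUnit.{u + 1}) (Equiv.refl (Bool × Bool))
  have hs : ∀ x, c (flipSide x) = flipSide (c x) := fun _ => rfl
  have he : ∀ x, c (flipEnd x) = flipEnd (c x) := fun _ => rfl
  have hv : ∀ x, X.vcol (Sum.inl x) (Sum.inl (flipEnd x)) ↔
      i.graph.vcol (Sum.inl (c x)) (Sum.inl (flipEnd (c x))) := by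
    intro x
    cases i with
    | bs =>
      exact iff_of_false (h.2 x) (not_vertexSetoid_flipEnd (EdgeKind.ribbonGraph .bs) (fun _ => rfl) (c x))
    | bp => exact iff_of_true (h.2 x) trivial
    | olc => exact iff_of_true (h.1 x ▸ X.vcol_arc x) trivial
    | olh => exact iff_of_true (h.1 x ▸ X.vcol_arc x) trivial
    | nl =>
      refine iff_of_true (X.vcol.trans (X.vcol_arc x) ?_) trivial
      rw [h x]
      exact X.vcol.symm (X.vcol_flipSide (flipEnd x))
  have hb : ∀ x, X.bcol (Sum.inl x) (Sum.inl (flipSide x)) ↔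
      i.graph.bcol (Sum.inl (c x)) (Sum.inl (flipSide (c x))) := by
    intro x
    cases i with
    | olc =>
      exact iff_of_false (h.2 x) (not_boundarySetoid_flipSide (EdgeKind.ribbonGraph .olc) (fun _ => rfl) (c x))
    | olh => exact iff_of_true (h.2 x) trivial
    | bs => exact iff_of_true (h.1 x ▸ X.bcol_arc x) trivial
    | bp => exact iff_of_true (h.1 x ▸ X.bcol_arc x) trivial
    | nl =>
      refine iff_of_true (X.bcol.trans (X.bcol_arc x) ?_) trivial
      rw [h x]
      exact X.bcol.symm (X.bcol_flipEnd (flipSide x))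
  have ha : ∀ x, c (X.arc x) = i.graph.arc (c x) := by
    intro x
    cases i with
    | bs => rw [h.1]; rfl
    | bp => rw [h.1]; rfl
    | olc => rw [h.1]; rfl
    | olh => rw [h.1]; rfl
    | nl => rw [h]; rfl
  refine ⟨c, Equiv.refl _, hs, he, ha, ?_, ?_⟩
  · rintro (x | ⟨⟨⟩⟩) (y | ⟨⟨⟩⟩)
    change X.vcol (Sum.inl x) (Sum.inl y) ↔ i.graph.vcol (Sum.inl (c x)) (Sum.inl (c y))
    -- Flipping the side stays at the vertex, so the diagonal corner needs no separate treatment: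
    -- colours are decided by the pair `x`, `flipEnd x`.
    have h1 : ∀ z, X.vcol (Sum.inl x) (Sum.inl (flipEnd z)) ↔
        X.vcol (Sum.inl x) (Sum.inl (flipEnd (flipSide z))) := fun z =>
      ⟨fun h => X.vcol.trans h (X.vcol_flipSide (flipEnd z)),
        fun h => X.vcol.trans h (X.vcol.symm (X.vcol_flipSide (flipEnd z)))⟩
    have h2 : ∀ z, i.graph.vcol (Sum.inl (c x)) (Sum.inl (flipEnd z)) ↔
        i.graph.vcol (Sum.inl (c x)) (Sum.inl (flipEnd (flipSide z))) := fun z =>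
      ⟨fun h => i.graph.vcol.trans h (i.graph.vcol_flipSide (flipEnd z)),
        fun h => i.graph.vcol.trans h (i.graph.vcol.symm (i.graph.vcol_flipSide (flipEnd z)))⟩
    rcases eq_flip_of_fst_eq (Subsingleton.elim (α := X.E) x.1 y.1) with rfl | rfl | rfl | rfl
    · exact iff_of_true (X.vcol.refl _) (i.graph.vcol.refl _)
    · exact iff_of_true (X.vcol_flipSide x) (i.graph.vcol_flipSide (c x))
    · exact hv x
    · exact (h1 x).symm.trans ((hv x).trans (h2 (c x)))
  · rintro (x | ⟨⟨⟩⟩) (y | ⟨⟨⟩⟩)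
    change X.bcol (Sum.inl x) (Sum.inl y) ↔ i.graph.bcol (Sum.inl (c x)) (Sum.inl (c y))
    have h1 : ∀ z, X.bcol (Sum.inl x) (Sum.inl (flipSide z)) ↔
        X.bcol (Sum.inl x) (Sum.inl (flipEnd (flipSide z))) := fun z =>
      ⟨fun h => X.bcol.trans h (X.bcol_flipEnd (flipSide z)),
        fun h => X.bcol.trans h (X.bcol.symm (X.bcol_flipEnd (flipSide z)))⟩
    have h2 : ∀ z, i.graph.bcol (Sum.inl (c x)) (Sum.inl (flipSide z)) ↔
        i.graph.bcol (Sum.inl (c x)) (Sum.inl (flipEnd (flipSide z))) := fun z =>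
      ⟨fun h => i.graph.bcol.trans h (i.graph.bcol_flipEnd (flipSide z)),
        fun h => i.graph.bcol.trans h (i.graph.bcol.symm (i.graph.bcol_flipEnd (flipSide z)))⟩
    rcases eq_flip_of_fst_eq (Subsingleton.elim (α := X.E) x.1 y.1) with rfl | rfl | rfl | rfl
    · exact iff_of_true (X.bcol.refl _) (i.graph.bcol.refl _)
    · exact hb x
    · exact iff_of_true (X.bcol_flipEnd x) (i.graph.bcol_flipEnd (c x))
    · exact (h1 x).symm.trans ((hb x).trans (h2 (c x)))

/-- The free arcs form one of three matchings of the four corners. Vertex colours split the first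
case and boundary colours the second. -/
lemma exists_isKind [Unique X.E] : ∃ i, X.IsKind i := by
  have harc : ∀ x, X.arc (default, x) = (default, (X.arc (default, x)).2) :=
    fun x => Prod.ext (Subsingleton.elim _ _) rfl
  have hinv : ∀ x, (X.arc (default, (X.arc (default, x)).2)).2 = x := fun x => by
    rw [← harc, X.arc_arc]
  have hne : ∀ x, (X.arc (default, x)).2 ≠ x := fun x h =>
    X.arc_ne (default, x) ((harc x).trans (by rw [h]))
  rcases involution_eq_of_forall_ne (fun x => (X.arc (default, x)).2) hinv hne with h | h | h
  · have h' : ∀ x, X.arc x = flipSide x := by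
      rintro ⟨e, x⟩
      obtain rfl := Subsingleton.elim default e
      rw [harc, h]; rfl
    by_cases hv : ∃ x : Corner X.E, X.vcol (Sum.inl x) (Sum.inl (flipEnd x))
    · obtain ⟨x₀, h₀⟩ := hv
      exact ⟨.bp, h', fun x => rel_of_rel_flipEnd Sum.inl X.vcol X.vcol_flipSide h₀ _ _⟩
    · exact ⟨.bs, h', fun x hx => hv ⟨x, hx⟩⟩
  · have h' : ∀ x, X.arc x = flipEnd x := by
      rintro ⟨e, x⟩
      obtain rfl := Subsingleton.elim default e
      rw [harc, h]; rfl
    by_cases hv : ∃ x : Corner X.E, X.bcol (Sum.inl x) (Sum.inl (flipSide x))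
    · obtain ⟨x₀, h₀⟩ := hv
      exact ⟨.olh, h', fun x => rel_of_rel_flipSide Sum.inl X.bcol X.bcol_flipEnd h₀ _ _⟩
    · exact ⟨.olc, h', fun x hx => hv ⟨x, hx⟩⟩
  · refine ⟨.nl, ?_⟩
    rintro ⟨e, x⟩
    obtain rfl := Subsingleton.elim default e
    rw [harc, h]; rfl

lemma exists_hasType (G : ColouredRibbonGraph.{u}) (e : G.E) : ∃ i j, G.HasType e i j := by
  have h1 : Unique (G.contract {e}ᶜ).E := ⟨⟨⟨e, by simp⟩⟩, fun x => Subtype.ext (by simpa using x.2)⟩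
  have h2 : Unique (G.delete {e}ᶜ).E := ⟨⟨⟨e, by simp⟩⟩, fun x => Subtype.ext (by simpa using x.2)⟩
  obtain ⟨i, hi⟩ := (G.contract {e}ᶜ).exists_isKind
  obtain ⟨j, hj⟩ := (G.delete {e}ᶜ).exists_isKind
  exact ⟨i, j, equivalent_of_isKind _ hi, equivalent_of_isKind _ hj⟩

/-! ### Change of the counts between deleting and contracting one edge -/

/-- The numbers of contracted edges, vertices, vertex colour classes and boundary colour classes of a
state, the first and the last with a minus sign. -/
noncomputable def stateVec (G : ColouredRibbonGraph.{u}) (A : Set G.E) : ℤ × ℤ × ℤ × ℤ :=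
  (-A.ncard, G.stateVertices A, G.stateVertexColours A, -G.stateBoundaryColours A)

end ColouredRibbonGraph

/-- The change of `stateVec` when the edge of a one-edge graph is deleted rather than contracted. -/
def EdgeKind.vec : EdgeKind → ℤ × ℤ × ℤ × ℤ
  | .bs => (1, 1, 1, 0)
  | .bp => (1, 1, 0, 0)
  | .olc => (1, -1, 0, 1)
  | .olh => (1, -1, 0, 0)
  | .nl => (1, 0, 0, 0)

namespace ColouredRibbonGraph

open RibbonGraph

variable (X : ColouredRibbonGraph.{u})

lemma finite_place (G : RibbonGraph.{u}) : Finite G.Place := by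
  have := G.finite_E
  have := G.finite_K
  infer_instance

lemma stateVertices_empty : X.stateVertices ∅ = Nat.card (Quotient X.vertexSetoid) := by
  unfold stateVertices minorVertexSetoid
  rw [turn_empty]; rfl

lemma stateVertices_univ : X.stateVertices Set.univ = Nat.card (Quotient X.boundarySetoid) := by
  unfold stateVertices minorVertexSetoid
  rw [turn_contraction_univ]; rfl

lemma stateVertexColours_empty : X.stateVertexColours ∅ = Nat.card (Quotient X.vcol) := by
  unfold stateVertexColours
  rw [mergeSetoid_empty, sup_bot_eq]

lemma stateBoundaryColours_univ : X.stateBoundaryColours Set.univ = Nat.card (Quotient X.bcol) := by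
  unfold stateBoundaryColours
  rw [Set.compl_univ, mergeSetoid_empty, sup_bot_eq]

/-- With these arcs the boundary relation is the vertex relation with the two ends of the edge
linked. Isolated vertices contribute equally to both counts, so comparing the relations avoids
computing either number. -/
lemma stateVertices_empty_of_arc_eq_flipSide [Unique X.E] (h : ∀ x, X.arc x = flipSide x) :
    X.stateVertices ∅ = X.stateVertices Set.univ + 1 := by
  have := finite_place X.toRibbonGraph
  let x₀ : Corner X.E := (default, false, false)
  rw [stateVertices_empty, stateVertices_univ]
  refine card_quotient_eq_add_of_pair _ _ (Sum.inl x₀) (Sum.inl (flipEnd x₀))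
    (X.orbitSetoid_le (X.orbitSetoid_arc _) fun x => h x ▸ X.orbitSetoid_arc _ x)
    (X.orbitSetoid_apply _ _) (fun U hU hx => ?_) (X.not_vertexSetoid_flipEnd h x₀)
  have hall := rel_of_rel_flipEnd Sum.inl U (fun x => hU (X.orbitSetoid_apply _ x)) hx
  exact X.orbitSetoid_le (fun x => hall _ _) fun x => hall _ _

lemma stateVertices_univ_of_arc_eq_flipEnd [Unique X.E] (h : ∀ x, X.arc x = flipEnd x) :
    X.stateVertices Set.univ = X.stateVertices ∅ + 1 := by
  have := finite_place X.toRibbonGraph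
  let x₀ : Corner X.E := (default, false, false)
  rw [stateVertices_empty, stateVertices_univ]
  refine card_quotient_eq_add_of_pair _ _ (Sum.inl x₀) (Sum.inl (flipSide x₀))
    (X.orbitSetoid_le (X.orbitSetoid_arc _) fun x => h x ▸ X.orbitSetoid_arc _ x)
    (X.orbitSetoid_apply _ _) (fun U hU hx => ?_) (X.not_boundarySetoid_flipSide h x₀)
  have hall := rel_of_rel_flipSide Sum.inl U (fun x => hU (X.orbitSetoid_apply _ x)) hx
  exact X.orbitSetoid_le (fun x => hall _ _) fun x => hall _ _

/-- Modulo free arcs the two flips agree, so the vertex relation and the boundary relation coincide.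
-/
lemma stateVertices_empty_of_arc_eq_flipEnd_flipSide (h : ∀ x, X.arc x = flipEnd (flipSide x)) :
    X.stateVertices ∅ = X.stateVertices Set.univ := by
  rw [stateVertices_empty, stateVertices_univ]
  congr 2
  refine le_antisymm (X.orbitSetoid_le (X.orbitSetoid_arc _) fun x => ?_)
    (X.orbitSetoid_le (X.orbitSetoid_arc _) fun x => ?_)
  · exact X.boundarySetoid.trans (h x ▸ X.orbitSetoid_arc _ x)
      (X.boundarySetoid.symm (X.orbitSetoid_apply _ (flipSide x)))
  · exact X.vertexSetoid.trans ((h x).trans (flipEnd_flipSide x) ▸ X.orbitSetoid_arc _ x)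
      (X.vertexSetoid.symm (X.orbitSetoid_apply _ (flipEnd x)))

lemma stateVertexColours_empty_of_not_vcol [Unique X.E] {x₀ : Corner X.E}
    (h : ¬ X.vcol (Sum.inl x₀) (Sum.inl (flipEnd x₀))) :
    X.stateVertexColours ∅ = X.stateVertexColours Set.univ + 1 := by
  have := finite_place X.toRibbonGraph
  rw [stateVertexColours_empty]
  have hr : X.mergeSetoid Set.univ ≤ X.vcol ⊔ X.mergeSetoid Set.univ := le_sup_right
  refine card_quotient_eq_add_of_pair _ _ (Sum.inl x₀) (Sum.inl (flipEnd x₀)) le_sup_left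
    (hr (X.mergeSetoid_apply trivial rfl)) (fun U hU hx => ?_) h
  have hall := rel_of_rel_flipEnd Sum.inl U (fun x => hU (X.vcol_flipSide x)) hx
  exact sup_le hU (X.mergeSetoid_le fun x y _ _ => hall x y)

lemma stateVertexColours_empty_of_vcol [Unique X.E] {x₀ : Corner X.E}
    (h : X.vcol (Sum.inl x₀) (Sum.inl (flipEnd x₀))) :
    X.stateVertexColours ∅ = X.stateVertexColours Set.univ := by
  have hall := rel_of_rel_flipEnd Sum.inl X.vcol X.vcol_flipSide h
  rw [stateVertexColours_empty, stateVertexColours,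
    sup_eq_left.2 (X.mergeSetoid_le fun x y _ _ => hall x y)]

lemma stateBoundaryColours_univ_of_not_bcol [Unique X.E] {x₀ : Corner X.E}
    (h : ¬ X.bcol (Sum.inl x₀) (Sum.inl (flipSide x₀))) :
    X.stateBoundaryColours Set.univ = X.stateBoundaryColours ∅ + 1 := by
  have := finite_place X.toRibbonGraph
  rw [stateBoundaryColours_univ, stateBoundaryColours, Set.compl_empty]
  have hr : X.mergeSetoid Set.univ ≤ X.bcol ⊔ X.mergeSetoid Set.univ := le_sup_right
  refine card_quotient_eq_add_of_pair _ _ (Sum.inl x₀) (Sum.inl (flipSide x₀)) le_sup_left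
    (hr (X.mergeSetoid_apply trivial rfl)) (fun U hU hx => ?_) h
  have hall := rel_of_rel_flipSide Sum.inl U (fun x => hU (X.bcol_flipEnd x)) hx
  exact sup_le hU (X.mergeSetoid_le fun x y _ _ => hall x y)

lemma stateBoundaryColours_univ_of_bcol [Unique X.E] {x₀ : Corner X.E}
    (h : X.bcol (Sum.inl x₀) (Sum.inl (flipSide x₀))) :
    X.stateBoundaryColours Set.univ = X.stateBoundaryColours ∅ := by
  have hall := rel_of_rel_flipSide Sum.inl X.bcol X.bcol_flipEnd h
  rw [stateBoundaryColours_univ, stateBoundaryColours, Set.compl_empty,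
    sup_eq_left.2 (X.mergeSetoid_le fun x y _ _ => hall x y)]

/-- The matching determines the change in the number of vertices. A colour count changes only if the
kind says that the two ends, or the two sides, have distinct colours; in the remaining cases the
arcs themselves, or the colour condition of the kind, make the merging vacuous. -/
lemma IsKind.stateVec_eq [Unique X.E] {i : EdgeKind} (h : X.IsKind i) :
    X.stateVec ∅ = X.stateVec Set.univ + i.vec := by
  have hcard : (Set.univ : Set X.E).ncard = 1 := by rw [Set.ncard_univ, Nat.card_unique]
  let x₀ : Corner X.E := (default, false, false)
  suffices hs : (X.stateVertices ∅ : ℤ) = X.stateVertices Set.univ + i.vec.2.1 ∧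
      (X.stateVertexColours ∅ : ℤ) = X.stateVertexColours Set.univ + i.vec.2.2.1 ∧
      -(X.stateBoundaryColours ∅ : ℤ) = -X.stateBoundaryColours Set.univ + i.vec.2.2.2 by
    obtain ⟨h1, h2, h3⟩ := hs
    have h0 : i.vec.1 = 1 := by cases i <;> rfl
    refine Prod.ext ?_ (Prod.ext h1 (Prod.ext h2 h3))
    simp [stateVec, hcard, h0]
  cases i with
  | bs =>
    have h1 := X.stateVertices_empty_of_arc_eq_flipSide h.1
    have h2 := X.stateVertexColours_empty_of_not_vcol (h.2 x₀)
    have h3 := X.stateBoundaryColours_univ_of_bcol (h.1 x₀ ▸ X.bcol_arc x₀)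
    rw [h1, h2, h3]
    simp [EdgeKind.vec]
  | bp =>
    have h1 := X.stateVertices_empty_of_arc_eq_flipSide h.1
    have h2 := X.stateVertexColours_empty_of_vcol (h.2 x₀)
    have h3 := X.stateBoundaryColours_univ_of_bcol (h.1 x₀ ▸ X.bcol_arc x₀)
    rw [h1, h2, h3]
    simp [EdgeKind.vec]
  | olc =>
    have h1 := X.stateVertices_univ_of_arc_eq_flipEnd h.1
    have h2 := X.stateVertexColours_empty_of_vcol (h.1 x₀ ▸ X.vcol_arc x₀)
    have h3 := X.stateBoundaryColours_univ_of_not_bcol (h.2 x₀)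
    rw [h1, h2, h3]
    simp [EdgeKind.vec]
  | olh =>
    have h1 := X.stateVertices_univ_of_arc_eq_flipEnd h.1
    have h2 := X.stateVertexColours_empty_of_vcol (h.1 x₀ ▸ X.vcol_arc x₀)
    have h3 := X.stateBoundaryColours_univ_of_bcol (h.2 x₀)
    rw [h1, h2, h3]
    simp [EdgeKind.vec]
  | nl =>
    have h1 := X.stateVertices_empty_of_arc_eq_flipEnd_flipSide h
    have h2 := X.stateVertexColours_empty_of_vcol (x₀ := x₀)
      (X.vcol.trans ((h x₀).trans (flipEnd_flipSide x₀) ▸ X.vcol_arc x₀) (X.vcol.symm (X.vcol_flipSide (flipEnd x₀))))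
    have h3 := X.stateBoundaryColours_univ_of_bcol (x₀ := x₀)
      (X.bcol.trans (h x₀ ▸ X.bcol_arc x₀) (X.bcol.symm (X.bcol_flipEnd (flipSide x₀))))
    rw [h1, h2, h3]
    simp [EdgeKind.vec]

lemma delete_stateVec (G : ColouredRibbonGraph.{u}) (B : Set G.E) (C : Set (G.delete B).E) :
    (G.delete B).stateVec C = G.stateVec (Subtype.val '' C) := by
  have h : (Subtype.val '' C).ncard = C.ncard :=
    Set.ncard_image_of_injective C Subtype.val_injective
  simp only [stateVec]
  rw [delete_stateVertices, delete_stateVertexColours, delete_stateBoundaryColours, h]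

/-- The correction appears because edges of `B` count as contracted in the state of `G` but are
absent from the minor. It cancels in all differences of state vectors. -/
lemma contract_stateVec (G : ColouredRibbonGraph.{u}) (B : Set G.E) (C : Set (G.contract B).E) :
    (G.contract B).stateVec C = G.stateVec (B ∪ Subtype.val '' C) + ((B.ncard : ℤ), (0 : ℤ), (0 : ℤ), (0 : ℤ)) := by
  have := G.finite_E
  have h : (Subtype.val '' C).ncard = C.ncard :=
    Set.ncard_image_of_injective C Subtype.val_injective
  have hd : Disjoint B (Subtype.val '' C) := Set.disjoint_left.2 fun a ha => by
    rintro ⟨e, _, rfl⟩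
    exact e.2 ha
  simp only [stateVec]
  rw [contract_stateVertices, contract_stateVertexColours, contract_stateBoundaryColours]
  have h2 := Set.ncard_union_eq hd (Set.toFinite _) (Set.toFinite _)
  rw [h] at h2
  rw [h2]
  simp

/-- Deleting or contracting `e` in `G / eᶜ` yields the states `{e}ᶜ` and `univ` of `G`. -/
lemma HasType.stateVec_compl {G : ColouredRibbonGraph.{u}} {e : G.E} {i j : EdgeKind}
    (h : G.HasType e i j) : G.stateVec {e}ᶜ = G.stateVec Set.univ + i.vec := by
  have : Unique (G.contract {e}ᶜ).E :=
    ⟨⟨⟨e, by simp⟩⟩, fun x => Subtype.ext (by simpa using x.2)⟩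
  have h1 := (isKind_of_equivalent _ h.1).stateVec_eq
  have h2 : ({e}ᶜ : Set G.E) ∪ Subtype.val '' (Set.univ : Set (G.contract {e}ᶜ).E) = Set.univ := by
    rw [← compl_compl (_ ∪ _)]
    refine (congrArg _ (compl_union_image_val _)).trans ?_
    have h3 : (Set.univ : Set (G.contract {e}ᶜ).E)ᶜ = ∅ := Set.compl_univ
    exact (congrArg (fun s => (Subtype.val '' s)ᶜ) h3).trans 
      ((congrArg _ (Set.image_empty _)).trans Set.compl_empty)
  have h4 : ({e}ᶜ : Set G.E) ∪ Subtype.val '' (∅ : Set (G.contract {e}ᶜ).E) = {e}ᶜ :=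
    (congrArg _ (Set.image_empty _)).trans (Set.union_empty _)
  rw [contract_stateVec, contract_stateVec, h2, h4, add_right_comm] at h1
  exact add_right_cancel h1

/-- Deleting or contracting `e` in `G \ eᶜ` yields the states `∅` and `{e}` of `G`. -/
lemma HasType.stateVec_empty {G : ColouredRibbonGraph.{u}} {e : G.E} {i j : EdgeKind}
    (h : G.HasType e i j) : G.stateVec ∅ = G.stateVec {e} + j.vec := by
  have : Unique (G.delete {e}ᶜ).E :=
    ⟨⟨⟨e, by simp⟩⟩, fun x => Subtype.ext (by simpa using x.2)⟩
  have h1 := (isKind_of_equivalent _ h.2).stateVec_eq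
  have h2 : Subtype.val '' (Set.univ : Set (G.delete {e}ᶜ).E) = {e} := by
    refine (Set.image_univ).trans (Subtype.range_val.trans ?_)
    ext x
    exact not_not
  have h3 : Subtype.val '' (∅ : Set (G.delete {e}ᶜ).E) = ∅ := Set.image_empty _
  rwa [delete_stateVec, delete_stateVec, h2, h3] at h1

end ColouredRibbonGraph

/-! ### Weights as a homomorphism from state vectors -/

/-- The product of the coefficients along a sequence of deletions (or contractions) in which `stateVec`
changes by `t`, for the coefficients `bs` and `olc` and the square roots `bp` and `olh`. -/
noncomputable def pathWeight {K : Type*} [Field K] (bs bp olc olh : K) (t : ℤ × ℤ × ℤ × ℤ) : K :=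
  bs ^ t.2.2.1 * olc ^ t.2.2.2 * bp ^ (t.1 + t.2.1 - 2 * t.2.2.1) *
    olh ^ (t.1 - t.2.1 - 2 * t.2.2.2)

lemma pathWeight_zero {K : Type*} [Field K] (bs bp olc olh : K) :
    pathWeight bs bp olc olh 0 = 1 := by
  simp [pathWeight]

/-- All exponents are linear in the vector. The bases must be nonzero because exponents may be
negative. -/
lemma pathWeight_add {K : Type*} [Field K] {bs bp olc olh : K} (h1 : bs ≠ 0) (h2 : bp ≠ 0)
    (h3 : olc ≠ 0) (h4 : olh ≠ 0) (s t : ℤ × ℤ × ℤ × ℤ) :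
    pathWeight bs bp olc olh (s + t) = pathWeight bs bp olc olh s * pathWeight bs bp olc olh t := by
  have e1 : (s + t).1 + (s + t).2.1 - 2 * (s + t).2.2.1 =
      (s.1 + s.2.1 - 2 * s.2.2.1) + (t.1 + t.2.1 - 2 * t.2.2.1) := by
    simp only [Prod.fst_add, Prod.snd_add]; ring
  have e2 : (s + t).1 - (s + t).2.1 - 2 * (s + t).2.2.2 =
      (s.1 - s.2.1 - 2 * s.2.2.2) + (t.1 - t.2.1 - 2 * t.2.2.2) := by
    simp only [Prod.fst_add, Prod.snd_add]; ring
  unfold pathWeight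
  rw [e1, e2, zpow_add₀ h2, zpow_add₀ h4]
  simp only [Prod.fst_add, Prod.snd_add]
  rw [zpow_add₀ h1, zpow_add₀ h3]
  ring

/-- An indeterminate as an element of the field of fractions. -/
noncomputable def fracVar (v : UVar) : FractionRing UPoly := algebraMap UPoly _ (MvPolynomial.X v)

lemma fracVar_ne_zero (v : UVar) : fracVar v ≠ 0 :=
  (map_ne_zero_iff _ (IsFractionRing.injective UPoly (FractionRing UPoly))).2 (MvPolynomial.X_ne_zero v)

/-- The product of the coefficients `a_i` along a sequence of deletions. -/
noncomputable def weightA : ℤ × ℤ × ℤ × ℤ → FractionRing UPoly :=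
  pathWeight (fracVar .aBs) (fracVar .aBpHalf) (fracVar .aOlc) (fracVar .aOlhHalf)

/-- The product of the coefficients `b_j` along a sequence of contractions. -/
noncomputable def weightB : ℤ × ℤ × ℤ × ℤ → FractionRing UPoly :=
  pathWeight (fracVar .bBs) (fracVar .bBpHalf) (fracVar .bOlc) (fracVar .bOlhHalf)

lemma weightA_add (s t : ℤ × ℤ × ℤ × ℤ) : weightA (s + t) = weightA s * weightA t :=
  pathWeight_add (fracVar_ne_zero _) (fracVar_ne_zero _) (fracVar_ne_zero _) (fracVar_ne_zero _) s t

lemma weightB_add (s t : ℤ × ℤ × ℤ × ℤ) : weightB (s + t) = weightB s * weightB t :=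
  pathWeight_add (fracVar_ne_zero _) (fracVar_ne_zero _) (fracVar_ne_zero _) (fracVar_ne_zero _) s t

/-- For a sum of kind vectors, the third and fourth coordinates count the bs and the olc, and the
two combined exponents equal 2 bp + nl and 2 olh + nl. Each nl thus contributes one factor of each
square root, as its coefficient requires. -/
lemma weightA_vec (i : EdgeKind) : weightA i.vec = algebraMap UPoly _ (coeffA i) := by
  cases i <;> simp [weightA, pathWeight, EdgeKind.vec, coeffA, fracVar]

lemma weightB_vec (i : EdgeKind) : weightB i.vec = algebraMap UPoly _ (coeffB i) := by
  cases i <;> simp [weightB, pathWeight, EdgeKind.vec, coeffB, fracVar]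

/-! ### Bijections of corners and of edges -/

lemma card_quotient_eq_of_equiv {P Q : Type*} (σ : P ≃ Q) (T' : Setoid P) (T : Setoid Q)
    (h1 : T' ≤ Setoid.comap σ T) (h2 : T ≤ Setoid.comap σ.symm T') :
    Nat.card (Quotient T') = Nat.card (Quotient T) :=
  Nat.card_congr (Quotient.congr σ fun p q =>
    ⟨fun h => h1 h, fun h => by
      have h3 : T' (σ.symm (σ p)) (σ.symm (σ q)) := h2 h
      rwa [σ.symm_apply_apply, σ.symm_apply_apply] at h3⟩)

namespace Corner

/-- The bijection of edges that underlies a bijection of corners. -/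
def edgeEquiv {E E' : Type u} (c : Corner E ≃ Corner E')
    (h : ∀ x y, x.1 = y.1 ↔ (c x).1 = (c y).1) : E ≃ E' where
  toFun e := (c (e, false, false)).1
  invFun e := (c.symm (e, false, false)).1
  left_inv e := by
    have := (h (c.symm ((c (e, false, false)).1, false, false)) (e, false, false)).2 (by simp)
    exact this
  right_inv e := by
    have := (h ((c.symm (e, false, false)).1, false, false) (c.symm (e, false, false))).1 rfl
    simpa using this

/-- The corners of an edge form one orbit of the flips, with which `c` commutes. -/
lemma fst_eq_iff {E E' : Type u} (c : Corner E ≃ Corner E')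
    (hs : ∀ x, c (flipSide x) = flipSide (c x)) (he : ∀ x, c (flipEnd x) = flipEnd (c x))
    (x y : Corner E) : x.1 = y.1 ↔ (c x).1 = (c y).1 := by
  constructor
  · intro h
    rcases eq_flip_of_fst_eq h with rfl | rfl | rfl | rfl <;> simp [hs, he] <;> rfl
  · intro h
    rcases eq_flip_of_fst_eq h with h | h | h | h
    · rw [c.injective h]
    · rw [← hs] at h; rw [c.injective h]; rfl
    · rw [← he] at h; rw [c.injective h]; rfl
    · rw [← hs, ← he] at h; rw [c.injective h]; rfl

end Corner

/-! ### The state sum and its recursion -/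

namespace ColouredRibbonGraph

open RibbonGraph

variable (G : ColouredRibbonGraph.{u})

/-- The contribution of the state in which the edges of `A` are contracted and the others are
deleted. -/
noncomputable def stateWeight (A : Set G.E) : FractionRing UPoly :=
  fracVar .alpha ^ G.stateVertexColours A * fracVar .beta ^ G.stateBoundaryColours A *
    fracVar .gamma ^ G.stateVertices A *
    weightA (G.stateVec A - G.stateVec Set.univ) * weightB (G.stateVec ∅ - G.stateVec A)

/-- The sum of the contributions of all states. -/
noncomputable def stateSum : FractionRing UPoly := ∑ᶠ A : Set G.E, G.stateWeight A

variable {G}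

/-- The all-contracted state of `G \ e` is the state `{e}ᶜ` of `G`, which differs from `univ` by the
vector of `i`; this shift of the base point is the factor `a_i`. The weight of the contractions is
unchanged, since `∅` remains `∅`. -/
lemma HasType.stateWeight_image_val {e : G.E} {i j : EdgeKind} (h : G.HasType e i j)
    (C : Set (G.delete {e}).E) :
    G.stateWeight (Subtype.val '' C) =
      algebraMap UPoly _ (coeffA i) * (G.delete {e}).stateWeight C := by
  have huniv : Subtype.val '' (Set.univ : Set (G.delete {e}).E) = {e}ᶜ :=
    Set.image_univ.trans Subtype.range_val
  have hempty : Subtype.val '' (∅ : Set (G.delete {e}).E) = ∅ := Set.image_empty _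
  have h1 : G.stateVec (Subtype.val '' C) - G.stateVec Set.univ =
      i.vec + (G.stateVec (Subtype.val '' C) - G.stateVec {e}ᶜ) := by
    rw [h.stateVec_compl]; abel
  unfold stateWeight
  rw [delete_stateVec, delete_stateVec, delete_stateVec, delete_stateVertices,
    delete_stateVertexColours, delete_stateBoundaryColours, huniv, hempty, h1, weightA_add,
    weightA_vec]
  ring

/-- Dually, the all-deleted state of `G / e` is the state `{e}` of `G`, which differs from `∅` by
the vector of `j`, while `univ` remains `univ`. -/
lemma HasType.stateWeight_union_image_val {e : G.E} {i j : EdgeKind} (h : G.HasType e i j)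
    (C : Set (G.contract {e}).E) :
    G.stateWeight ({e} ∪ Subtype.val '' C) =
      algebraMap UPoly _ (coeffB j) * (G.contract {e}).stateWeight C := by
  have huniv : ({e} : Set G.E) ∪ Subtype.val '' (Set.univ : Set (G.contract {e}).E) = Set.univ := by
    have : Subtype.val '' (Set.univ : Set (G.contract {e}).E) = {e}ᶜ :=
      Set.image_univ.trans Subtype.range_val
    rw [this, Set.union_compl_self]
  have hempty : ({e} : Set G.E) ∪ Subtype.val '' (∅ : Set (G.contract {e}).E) = {e} :=
    (congrArg _ (Set.image_empty _)).trans (Set.union_empty _)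
  have h1 : G.stateVec ∅ - G.stateVec ({e} ∪ Subtype.val '' C) =
      j.vec + (G.stateVec {e} - G.stateVec ({e} ∪ Subtype.val '' C)) := by
    rw [h.stateVec_empty]; abel
  unfold stateWeight
  rw [contract_stateVec, contract_stateVec, contract_stateVec, contract_stateVertices,
    contract_stateVertexColours, contract_stateBoundaryColours, huniv, hempty, h1, weightB_add,
    weightB_vec, add_sub_add_right_eq_sub, add_sub_add_right_eq_sub]
  ring

end ColouredRibbonGraph

/-- The sets that do not contain `a` and the sets that contain `a`. -/
lemma bijective_image_val_union {α : Type*} (a : α) :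
    Function.Bijective (Sum.elim (fun C : Set {x // x ∉ ({a} : Set α)} => Subtype.val '' C)
      (fun C : Set {x // x ∉ ({a} : Set α)} => {a} ∪ Subtype.val '' C)) := by
  have hnot : ∀ C : Set {x // x ∉ ({a} : Set α)}, a ∉ Subtype.val '' C := by
    rintro C ⟨x, _, hx⟩
    exact x.2 hx
  constructor
  · rintro (C | C) (D | D) h
    · exact congrArg _ (Set.image_injective.2 Subtype.val_injective h)
    · exact (hnot C (by rw [show Subtype.val '' C = {a} ∪ Subtype.val '' D from h]; simp)).elim
    · exact (hnot D (by rw [← show {a} ∪ Subtype.val '' C = Subtype.val '' D from h]; simp)).elim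
    · refine congrArg _ (Set.ext fun x => ?_)
      have h1 := Set.ext_iff.1 (show {a} ∪ Subtype.val '' C = {a} ∪ Subtype.val '' D from h) x.1
      have h2 : x.1 ≠ a := x.2
      simpa [h2] using h1
  · intro A
    have himage : Subtype.val '' (Subtype.val ⁻¹' A : Set {x // x ∉ ({a} : Set α)}) = A \ {a} := by
      ext x; simp [and_comm]
    by_cases h : a ∈ A
    · refine ⟨Sum.inr (Subtype.val ⁻¹' A), ?_⟩
      change {a} ∪ Subtype.val '' (Subtype.val ⁻¹' A : Set {x // x ∉ ({a} : Set α)}) = A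
      rw [himage, Set.union_sdiff_cancel (by simpa using h)]
    · refine ⟨Sum.inl (Subtype.val ⁻¹' A), ?_⟩
      change Subtype.val '' (Subtype.val ⁻¹' A : Set {x // x ∉ ({a} : Set α)}) = A
      rw [himage, Set.sdiff_singleton_eq_self h]

lemma finsum_set_eq_add {α M : Type*} [AddCommMonoid M] [Finite α] (a : α) (f : Set α → M) :
    ∑ᶠ A, f A = (∑ᶠ C : Set {x // x ∉ ({a} : Set α)}, f (Subtype.val '' C)) +
      ∑ᶠ C : Set {x // x ∉ ({a} : Set α)}, f ({a} ∪ Subtype.val '' C) := by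
  classical
  have := Fintype.ofFinite (Set {x // x ∉ ({a} : Set α)})
  rw [← finsum_comp_equiv (Equiv.ofBijective _ (bijective_image_val_union a)),
    finsum_eq_sum_of_fintype, Fintype.sum_sum_type, finsum_eq_sum_of_fintype, finsum_eq_sum_of_fintype]
  rfl

namespace ColouredRibbonGraph

open RibbonGraph

variable {G : ColouredRibbonGraph.{u}}

lemma HasType.stateSum_eq {e : G.E} {i j : EdgeKind} (h : G.HasType e i j) :
    G.stateSum = algebraMap UPoly _ (coeffA i) * (G.delete {e}).stateSum +
      algebraMap UPoly _ (coeffB j) * (G.contract {e}).stateSum := by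
  have := G.finite_E
  unfold stateSum
  rw [mul_finsum, mul_finsum, finsum_set_eq_add e]
  exact congrArg₂ _ (finsum_congr fun C => h.stateWeight_image_val C)
    (finsum_congr fun C => h.stateWeight_union_image_val C)

lemma stateSum_of_isEmpty (h : IsEmpty G.E) :
    G.stateSum = algebraMap UPoly _ (MvPolynomial.X .alpha ^ G.numVertexColours *
      MvPolynomial.X .beta ^ G.numBoundaryColours * MvPolynomial.X .gamma ^ G.numVertices) := by
  have huniv : (Set.univ : Set G.E) = ∅ := Set.univ_eq_empty_iff.2 h
  have h1 : G.stateBoundaryColours ∅ = G.numBoundaryColours := by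
    rw [← huniv]; exact G.stateBoundaryColours_univ
  have h2 : G.stateVertexColours ∅ = G.numVertexColours := G.stateVertexColours_empty
  have h3 : G.stateVertices ∅ = G.numVertices := G.stateVertices_empty
  unfold stateSum
  -- The only state is both `∅` and `univ`, so both weights are taken at the zero vector.
  rw [finsum_eq_single _ ∅ fun A hA => (hA (Set.eq_empty_of_isEmpty A)).elim]
  simp only [stateWeight, huniv, sub_self, h1, h2, h3]
  simp [weightA, weightB, pathWeight_zero, fracVar]

lemma card_delete_lt (G : ColouredRibbonGraph.{u}) (e : G.E) : Nat.card (G.delete {e}).E < Nat.card G.E :=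
  have := G.finite_E
  Finite.card_subtype_lt (p := fun x => x ∉ ({e} : Set G.E)) (x := e) (by simp)

lemma card_contract_lt (G : ColouredRibbonGraph.{u}) (e : G.E) : Nat.card (G.contract {e}).E < Nat.card G.E :=
  G.card_delete_lt e

/-- Induction on the number of edges. -/
lemma minor_induction {P : ColouredRibbonGraph.{u} → Prop}
    (edgeless : ∀ G : ColouredRibbonGraph.{u}, IsEmpty G.E → P G)
    (edge : ∀ (G : ColouredRibbonGraph.{u}) (e : G.E), P (G.delete {e}) → P (G.contract {e}) → P G)
    (G : ColouredRibbonGraph.{u}) : P G := by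
  induction hn : Nat.card G.E using Nat.strong_induction_on generalizing G with
  | _ n ih =>
    subst hn
    rcases isEmpty_or_nonempty G.E with h | ⟨⟨e⟩⟩
    · exact edgeless G h
    · exact edge G e (ih _ (G.card_delete_lt e) _ rfl) (ih _ (G.card_contract_lt e) _ rfl)

/-- Possible denominators do not survive: the recursion builds the sum from polynomials with
polynomial coefficients. -/
lemma exists_algebraMap_eq_stateSum (G : ColouredRibbonGraph.{u}) :
    ∃ p : UPoly, algebraMap UPoly _ p = G.stateSum := by
  induction G using minor_induction with
  | edgeless G h => exact ⟨_, (stateSum_of_isEmpty h).symm⟩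
  | edge G e h1 h2 =>
    obtain ⟨i, j, h⟩ := G.exists_hasType e
    obtain ⟨p, hp⟩ := h1
    obtain ⟨q, hq⟩ := h2
    exact ⟨coeffA i * p + coeffB j * q, by rw [h.stateSum_eq, map_add, map_mul, map_mul, hp, hq]⟩

/-- The bijection of corners induces one of edges, hence of states. Every count of a state is
defined from flips, arcs and colours, so corresponding states have equal contributions. -/
lemma Equivalent.stateSum_eq {H : ColouredRibbonGraph.{u}} (h : G.Equivalent H) : G.stateSum = H.stateSum := by
  classical
  obtain ⟨c, k, hs, he, ha, hv, hb⟩ := h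
  have hfst := fst_eq_iff c hs he
  let ε : G.E ≃ H.E := edgeEquiv c hfst
  have hε : ∀ x, (c x).1 = ε x.1 := fun x => (hfst x (x.1, false, false)).1 rfl
  have hmem : ∀ (A : Set G.E) (x : Corner G.E), (c x).1 ∈ ε '' A ↔ x.1 ∈ A := fun A x => by
    rw [hε, ε.injective.mem_set_image]
  let σ : G.Place ≃ H.Place := Equiv.sumCongr c k
  have hgen : ∀ (S : Setoid G.Place) (S' : Setoid H.Place),
      (∀ p q, S p q ↔ S' (Sum.map c k p) (Sum.map c k q)) → ∀ A : Set G.E,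
      Nat.card (Quotient (S ⊔ G.mergeSetoid A)) = Nat.card (Quotient (S' ⊔ H.mergeSetoid (ε '' A))) := by
    intro S S' hS A
    have hr : G.mergeSetoid A ≤ S ⊔ G.mergeSetoid A := le_sup_right
    have hr' : H.mergeSetoid (ε '' A) ≤ S' ⊔ H.mergeSetoid (ε '' A) := le_sup_right
    have hl : S ≤ S ⊔ G.mergeSetoid A := le_sup_left
    have hl' : S' ≤ S' ⊔ H.mergeSetoid (ε '' A) := le_sup_left
    refine card_quotient_eq_of_equiv σ _ _ (sup_le (fun p q h => hl' ((hS p q).1 h)) ?_)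
      (sup_le (fun p q h => hl ((hS _ _).2 ?_)) ?_)
    · exact G.mergeSetoid_le fun x y hx hxy =>
        hr' (H.mergeSetoid_apply ((hmem A x).2 hx) ((hfst x y).1 hxy))
    · have h1 := σ.apply_symm_apply p
      have h2 := σ.apply_symm_apply q
      rw [← h1, ← h2] at h
      exact h
    · refine H.mergeSetoid_le fun x y hx hxy => ?_
      obtain ⟨x, rfl⟩ := c.surjective x
      obtain ⟨y, rfl⟩ := c.surjective y
      have := hr (G.mergeSetoid_apply ((hmem A x).1 hx) ((hfst x y).2 hxy))
      change (S ⊔ G.mergeSetoid A) (Sum.inl (c.symm (c x))) (Sum.inl (c.symm (c y)))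
      simpa using this
  have hvert : ∀ A : Set G.E, G.stateVertices A = H.stateVertices (ε '' A) := by
    intro A
    have hturn : ∀ x, c (G.turn .contraction A x) = H.turn .contraction (ε '' A) (c x) := by
      intro x
      by_cases h : x.1 ∈ A
      · rw [turn, turn, if_pos h, if_pos ((hmem A x).2 h)]
        exact he x
      · rw [turn, turn, if_neg h, if_neg ((hmem A x).not.2 h)]
        exact hs x
    refine card_quotient_eq_of_equiv σ _ _ (G.orbitSetoid_le (fun x => ?_) fun x => ?_)
      (H.orbitSetoid_le (fun x => ?_) fun x => ?_)
    · change H.minorVertexSetoid _ _ (Sum.inl (c x)) (Sum.inl (c (G.arc x)))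
      rw [ha]
      exact H.orbitSetoid_arc _ _
    · change H.minorVertexSetoid _ _ (Sum.inl (c x)) (Sum.inl (c (G.turn _ _ x)))
      rw [hturn]
      exact H.orbitSetoid_apply _ _
    · obtain ⟨x, rfl⟩ := c.surjective x
      change G.minorVertexSetoid _ _ (Sum.inl (c.symm (c x))) (Sum.inl (c.symm (H.arc (c x))))
      rw [← ha, c.symm_apply_apply, c.symm_apply_apply]
      exact G.orbitSetoid_arc _ _
    · obtain ⟨x, rfl⟩ := c.surjective x
      change G.minorVertexSetoid _ _ (Sum.inl (c.symm (c x)))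
        (Sum.inl (c.symm (H.turn _ _ (c x))))
      rw [← hturn, c.symm_apply_apply, c.symm_apply_apply]
      exact G.orbitSetoid_apply _ _
  have hvcol : ∀ A : Set G.E, G.stateVertexColours A = H.stateVertexColours (ε '' A) :=
    hgen G.vcol H.vcol hv
  have hbcol : ∀ A : Set G.E, G.stateBoundaryColours A = H.stateBoundaryColours (ε '' A) := by
    intro A
    -- Boundary colours are merged along the deleted edges, hence the complement.
    have := hgen G.bcol H.bcol hb Aᶜ
    rwa [Set.image_compl_eq ε.bijective] at this
  have hvec : ∀ A : Set G.E, G.stateVec A = H.stateVec (ε '' A) := by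
    intro A
    simp only [stateVec, ← hvert, ← hvcol, ← hbcol, Set.ncard_image_of_injective A ε.injective]
  unfold stateSum
  rw [← finsum_comp_equiv (Equiv.Set.congr ε)]
  refine finsum_congr fun A => ?_
  change G.stateWeight A = H.stateWeight (ε '' A)
  have hu : H.stateVec Set.univ = G.stateVec Set.univ := by
    rw [hvec, Set.image_univ, ε.surjective.range_eq]
  have h0 : H.stateVec ∅ = G.stateVec ∅ := by
    rw [hvec, Set.image_empty]
  simp only [stateWeight, ← hvert, ← hvcol, ← hbcol, ← hvec, hu, h0]

end ColouredRibbonGraph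

theorem theorem3p4 :
    ∃ U : ColouredRibbonGraph.{u} → UPoly,
      IsDeletionContraction U ∧
      (∀ G H : ColouredRibbonGraph.{u}, G.Equivalent H → U G = U H) ∧
      ∀ U' : ColouredRibbonGraph.{u} → UPoly, IsDeletionContraction U' → U' = U := by
  choose U hU using ColouredRibbonGraph.exists_algebraMap_eq_stateSum.{u}
  have hinj : Function.Injective (algebraMap UPoly (FractionRing UPoly)) :=
    IsFractionRing.injective _ _
  -- The relations hold for the state sum in the field of fractions and descend by injectivity.
  have hDC : IsDeletionContraction U :=
    { edge := fun G e i j h => hinj (by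
        rw [map_add, map_mul, map_mul, hU, hU, hU, h.stateSum_eq])
      edgeless := fun G h => hinj (by rw [hU, ColouredRibbonGraph.stateSum_of_isEmpty h]) }
  refine ⟨U, hDC, fun G H h => hinj (by rw [hU, hU, h.stateSum_eq]), fun U' hU' => funext fun G => ?_⟩
  induction G using ColouredRibbonGraph.minor_induction with
  | edgeless G h => rw [hU'.edgeless G h, hDC.edgeless G h]
  | edge G e h1 h2 =>
    -- Existence of a type is what makes the relation available at `e`, so the values on the two
    -- minors force the value on `G`.
    obtain ⟨i, j, h⟩ := G.exists_hasType e
    rw [hU'.edge G e i j h, hDC.edge G e i j h, h1, h2]
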